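/- Let $h:\mathbb{R}^{d_x}\to\mathbb{R}$, $c:\mathbb{R}^{d_x}\to\mathbb{R}^{d_y}$, $f(x,y)=h(x)+y^{\mathsf T}c(x)$, $\mathcal{Y}=\{y\in\mathbb{R}^{d_y}: 0\le y\le \overline{y}\}$ (coordinatewise), and $\Phi(x)=\max_{y\in\mathcal{Y}}f(x,y)$. Assume that $\Phi(x)\ge\underline{f}$ for all $x$, and that for some $L>0$ the function $f$ is differentiable with $\|\nabla f(x_1,y_1)-\nabla f(x_2,y_2)\|\le L(\|x_1-x_2\|+\|y_1-y_2\|)$ for all $x_1,x_2\in\mathbb{R}^{d_x}$, $y_1,y_2\in\mathcal{Y}$. Write $K(x,y;z)=f(x,y)+\frac p2\|x-z\|^2$, let $\mathcal{P}_{\mathcal{Y}}$ be the Euclidean projection onto $\mathcal{Y}$, and $$\mathfrak{g}(x,y)=\begin{pmatrix}\nabla_x f(x,y)\\ \frac1\beta\left(y-\mathcal{P}_{\mathcal{Y}}[y+\beta\nabla_y f(x,y)]\right)\end{pmatrix}.$$ ZOB-SGDA with block size $b\in\{1,\dots,d_x\}$, smoothing radii $r_k>0$ and step sizes $\alpha,\beta,\gamma>0$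 starts from $x_0\in\mathbb{R}^{d_x}$, $y_0\in\mathcal{Y}$, $z_0=x_0$. For $k=0,1,\dots,K-1$ it draws, independently of the past, a uniformly distributed $b$-element subset $\mathcal{I}_k\subseteq\{1,\dots,d_x\}$ and sets $$x_{k+1}=x_k-\alpha\sum_{i\in\mathcal{I}_k}\Big(\frac{f(x_k+r_ke_i,y_k)-f(x_k,y_k)}{r_k}+p\,(x_k(i)-z_k(i))\Big)e_i,$$ $$y_{k+1}=\mathcal{P}_{\mathcal{Y}}[y_k+\beta\nabla_yK(x_k,y_k;z_k)],\qquad z_{k+1}=\gamma x_{k+1}+(1-\gamma)z_k.$$ Let $N=d_x/b$, $K\ge1$, $p\ge3L$, $\sum_{k=0}^{K}r_k^2\le\frac1b$, $0<\alpha\le\frac1{p+10L+1}$, and $$\overline\beta=\min\left\{\frac1{12L},\frac{\alpha^2(p-L)^2}{4L(\sqrt N+\alpha(p-L))^2}\right\},\qquad \overline\gamma=\min\left\{\sqrt{\frac1{KN}},\frac1{36},\frac1{768p\beta}\right\}.$$ Let $\beta\le\overline\beta$ and $\gamma\le\overline\gamma$ be of the order of these bounds, i.e. $\theta\overline\beta\le\beta\le\overline\beta$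 and $\theta\overline\gamma\le\gamma\le\overline\gamma$ for some constant $\theta>0$. Then $$\min_{0\le k\le K-1}\mathbb{E}\left[\|\mathfrak{g}(x_k,y_k)\|\right]\le C\left(\frac NK\right)^{1/4},$$ where $C$ depends only on $L,p,\alpha,\theta$, on an upper bound of $\|\overline y\|$, and on a common upper bound of $\Phi(x_0)-\underline{f}$ and $\|\nabla f(x_0,y_0)\|$; in particular it does not depend on $K$, $b$, $d_x$, $d_y$ or the $r_k$. -/

import Mathlib

open scoped RealInnerProductSpace

noncomputable section

namespace ZOB

/-- Euclidean space of dimension `n`, with the `ℓ²` norm. -/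
abbrev Vec (n : ℕ) := EuclideanSpace ℝ (Fin n)

variable {dx dy : ℕ}

/-- The Lagrange function `f(x, y) = h(x) + yᵀ c(x)`. -/
def lagr (h : Vec dx → ℝ) (c : Vec dx → Vec dy) (x : Vec dx) (y : Vec dy) : ℝ :=
  h x + ∑ j, y j * c x j

/-- The box `𝒴 = {y | 0 ≤ y ≤ ȳ}` (coordinatewise). -/
def box (ybar : Vec dy) : Set (Vec dy) := {y | ∀ j, 0 ≤ y j ∧ y j ≤ ybar j}

/-- The Euclidean projection onto the box; see `projBox_unique_nearest`. -/
def projBox (ybar v : Vec dy) : Vec dy :=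
  WithLp.toLp 2 fun j => max 0 (min (ybar j) (v j))

/-- On a nonempty box, `projBox ybar v` is the unique point of the box nearest to `v`. -/
theorem projBox_unique_nearest (ybar v w : Vec dy) (hne : (box ybar).Nonempty) :
    w = projBox ybar v ↔ w ∈ box ybar ∧ ∀ u ∈ box ybar, ‖v - w‖ ≤ ‖v - u‖ := by
  obtain ⟨a, ha⟩ := hne
  have hpos : ∀ j, 0 ≤ ybar j := fun j => (ha j).1.trans (ha j).2
  have hmem : projBox ybar v ∈ box ybar := fun j =>
    ⟨le_max_left _ _, max_le (hpos j) (min_le_left _ _)⟩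
  -- obtuse-angle inequality, coordinate by coordinate
  have hco : ∀ u ∈ box ybar, ∀ j,
      (v j - projBox ybar v j) ^ 2 + (projBox ybar v j - u j) ^ 2 ≤ (v j - u j) ^ 2 := by
    intro u hu j
    have h1 := hu j
    have h2 := hpos j
    show (v j - max 0 (min (ybar j) (v j))) ^ 2 + (max 0 (min (ybar j) (v j)) - u j) ^ 2
      ≤ (v j - u j) ^ 2
    rcases le_total (ybar j) (v j) with h | h
    · rw [min_eq_left h, max_eq_right h2]
      nlinarith [mul_nonneg (sub_nonneg.2 h) (sub_nonneg.2 h1.2)]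
    · rw [min_eq_right h]
      rcases le_total 0 (v j) with h' | h'
      · rw [max_eq_right h']; nlinarith
      · rw [max_eq_left h']; nlinarith [mul_nonneg (neg_nonneg.2 h') h1.1]
  have hsq : ∀ u ∈ box ybar,
      ‖v - projBox ybar v‖ ^ 2 + ‖projBox ybar v - u‖ ^ 2 ≤ ‖v - u‖ ^ 2 := by
    intro u hu
    simp only [EuclideanSpace.real_norm_sq_eq, ← Finset.sum_add_distrib]
    exact Finset.sum_le_sum fun j _ => hco u hu j
  constructor
  · rintro rfl
    refine ⟨hmem, fun u hu => ?_⟩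
    have := hsq u hu
    exact le_of_sq_le_sq (by nlinarith [sq_nonneg ‖projBox ybar v - u‖]) (norm_nonneg _)
  · rintro ⟨hw, hmin⟩
    have h1 := hsq w hw
    have h2 := hmin _ hmem
    have h3 : ‖v - w‖ ^ 2 ≤ ‖v - projBox ybar v‖ ^ 2 :=
      pow_le_pow_left₀ (norm_nonneg _) h2 2
    have h4 : ‖projBox ybar v - w‖ ^ 2 ≤ 0 := by linarith
    have h5 : ‖projBox ybar v - w‖ = 0 := by
      have := norm_nonneg (projBox ybar v - w)
      nlinarith
    exact (sub_eq_zero.1 (norm_eq_zero.1 h5)).symm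

/-- `Φ(x) = max_{y ∈ 𝒴} f(x, y)`. -/
def Phi (f : Vec dx → Vec dy → ℝ) (ybar : Vec dy) (x : Vec dx) : ℝ :=
  sSup (f x '' box ybar)

/-- The partial gradient `∇ₓ f(x, y)`. -/
def gradX (f : Vec dx → Vec dy → ℝ) (x : Vec dx) (y : Vec dy) : Vec dx :=
  gradient (fun u => f u y) x

/-- The partial gradient `∇_y f(x, y)`. -/
def gradY (f : Vec dx → Vec dy → ℝ) (x : Vec dx) (y : Vec dy) : Vec dy :=
  gradient (fun v => f x v) y

/-- The full gradient `∇ f(x, y) = (∇ₓ f(x, y), ∇_y f(x, y))`, with the `ℓ²` norm on pairs. -/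
def gradXY (f : Vec dx → Vec dy → ℝ) (x : Vec dx) (y : Vec dy) :
    WithLp 2 (Vec dx × Vec dy) :=
  WithLp.toLp 2 (gradX f x y, gradY f x y)

/-- `f` is differentiable and `L`-smooth on `ℝ^{dx} × 𝒴`. -/
structure IsLSmooth (f : Vec dx → Vec dy → ℝ) (ybar : Vec dy) (L : ℝ) : Prop where
  differentiable : ∀ x, ∀ y ∈ box ybar,
    DifferentiableAt ℝ (fun q : Vec dx × Vec dy => f q.1 q.2) (x, y)
  lipschitz : ∀ x₁ x₂, ∀ y₁ ∈ box ybar, ∀ y₂ ∈ box ybar,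
    ‖gradXY f x₁ y₁ - gradXY f x₂ y₂‖ ≤ L * (‖x₁ - x₂‖ + ‖y₁ - y₂‖)

/-- The proximal-gradient stationarity measure
`𝔤(x, y) = (∇ₓ f(x, y), (1/β) (y - P_𝒴[y + β ∇_y f(x, y)]))`. -/
def proxGrad (f : Vec dx → Vec dy → ℝ) (ybar : Vec dy) (β : ℝ) (x : Vec dx) (y : Vec dy) :
    WithLp 2 (Vec dx × Vec dy) :=
  WithLp.toLp 2 (gradX f x y, (1 / β) • (y - projBox ybar (y + β • gradY f x y)))

/-- The smoothed function `K(x, y; z) = f(x, y) + (p/2) ‖x - z‖²`. -/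
def smoothed (f : Vec dx → Vec dy → ℝ) (p : ℝ) (z x : Vec dx) (y : Vec dy) : ℝ :=
  f x y + p / 2 * ‖x - z‖ ^ 2

/-- The `i`-th standard basis vector. -/
def basisVec (i : Fin dx) : Vec dx := EuclideanSpace.single i 1

/-- The block coordinate-wise gradient estimate `G_x^I(x, y; z)` with smoothing radius `r`. -/
def blockEst (f : Vec dx → Vec dy → ℝ) (p r : ℝ) (I : Finset (Fin dx))
    (x : Vec dx) (y : Vec dy) (z : Vec dx) : Vec dx :=
  ∑ i ∈ I, (((f (x + r • basisVec i) y - f x y) / r) • basisVec i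
    + (p * (x i - z i)) • basisVec i)

/-- The state `(x, y, z)` of the algorithm. -/
structure State (dx dy : ℕ) where
  x : Vec dx
  y : Vec dy
  z : Vec dx

/-- One step of ZOB-SGDA with the sampled block `I` and the smoothing radius `r`. -/
def step (f : Vec dx → Vec dy → ℝ) (ybar : Vec dy) (p α β γ r : ℝ) (I : Finset (Fin dx))
    (s : State dx dy) : State dx dy :=
  let x' := s.x - α • blockEst f p r I s.x s.y s.z
  { x := x'
    y := projBox ybar (s.y + β • gradY (smoothed f p s.z) s.x s.y)
    z := γ • x' + (1 - γ) • s.z }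

/-- The iterates `(x_k, y_k, z_k)` of ZOB-SGDA along a given sequence of blocks, from
`(x₀, y₀)` and `z₀ = x₀`. -/
def iterate (f : Vec dx → Vec dy → ℝ) (ybar : Vec dy) (p α β γ : ℝ) (r : ℕ → ℝ)
    (x₀ : Vec dx) (y₀ : Vec dy) (I : ℕ → Finset (Fin dx)) : ℕ → State dx dy
  | 0 => ⟨x₀, y₀, x₀⟩
  | k + 1 => step f ybar p α β γ (r k) (I k) (iterate f ybar p α β γ r x₀ y₀ I k)

/-- The blocks `I 0, I 1, …` are independent and each is uniformly distributed on the subsets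
of `[dx]` with exactly `b` elements. -/
structure IsBlockSampling {Ω : Type*} [MeasurableSpace Ω] (μ : MeasureTheory.Measure Ω)
    (b : ℕ) (I : ℕ → Ω → Finset (Fin dx)) : Prop where
  measurable : ∀ k s, MeasurableSet {ω | I k ω = s}
  uniform : ∀ k s, μ.real {ω | I k ω = s} = if s.card = b then 1 / (dx.choose b : ℝ) else 0
  indep : ProbabilityTheory.iIndepFun (m := fun _ => (⊤ : MeasurableSpace (Finset (Fin dx)))) I μ

/-- The upper bound on the dual step size `β`. -/
def betaMax (L p α N : ℝ) : ℝ :=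
  min (1 / (12 * L)) (α ^ 2 * (p - L) ^ 2 / (4 * L * (√N + α * (p - L)) ^ 2))

/-- The upper bound on the averaging parameter `γ`. -/
def gammaMax (p β N : ℝ) (K : ℕ) : ℝ :=
  min (√(1 / (K * N))) (min (1 / 36) (1 / (768 * p * β)))

end ZOB

end

/-! Since p > L, the proximal term makes K(·, y; z) strongly convex. Put d(y, z) = min over x of K
and P(z) = max over y ∈ 𝒴 of d. The proof is a Lyapunov argument for V = K − 2d + 2P = (K − d) + (P
− d) + P, which stays above the lower bound of Φ because a dual maximizer and its primal minimizer
form a saddle point (`IsLSmooth.inner_argmaxY_le`, `IsLSmooth.le_potential`).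

In one step the x-move lowers K by the squared gradient on the sampled coordinates, the projected
y-move gains ‖y' − y‖²/β, and the z-move gains γ‖x − z‖² at the price of shifting minimizers. As f
is only affine in y, that shift has no bound proportional to the residual:
`IsLSmooth.dual_error_bound` controls its square by the first power of the residual, times the
diameter of 𝒴. Young's inequality then absorbs everything except an error of order γ²/β + γ³ +
γ²N/α. Because γ² ≤ 1/(KN) and β is at least of order 1/N, K such errors add up to a constant.

Averaging over a uniform block multiplies coordinate sums by b/dx = 1/N
(`IsLSmooth.average_potential_step_le`), and telescoping bounds the total expected decrease by a
constant. With q = √(KN), the squared stationarity measure is at most a constant times q times the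
decrease, so some k < K has second moment O(q/K) = O(√(N/K)); Jensen's inequality gives the fourth
root. If K < N, the initial point already suffices. -/

open scoped RealInnerProductSpace

noncomputable section

namespace ZOB

variable {dx dy : ℕ}

/-! ### Quadratic bounds for functions with Lipschitz gradient -/

section General

variable {E : Type*} [NormedAddCommGroup E] [InnerProductSpace ℝ E] [CompleteSpace E]

/-- Along the segment, φ minus its linear part and minus (L/2) t² ‖v‖² has nonpositive derivative by
Cauchy–Schwarz, so comparing t = 0 with t = 1 suffices. -/
lemma le_add_inner_add_of_lipschitz_gradient {φ : E → ℝ} {g : E → E} {L : ℝ}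
    (hg : ∀ x, HasGradientAt φ (g x) x) (hL : ∀ x u, ‖g x - g u‖ ≤ L * ‖x - u‖) (x u : E) :
    φ u ≤ φ x + ⟪g x, u - x⟫ + L / 2 * ‖u - x‖ ^ 2 := by
  set v := u - x with hv
  have hline : ∀ t : ℝ, HasDerivAt (fun t : ℝ => x + t • v) v t := fun t => by
    simpa using ((hasDerivAt_id t).smul_const v).const_add x
  have hφ : ∀ t : ℝ, HasDerivAt (fun t : ℝ => φ (x + t • v)) ⟪g (x + t • v), v⟫ t := fun t => by
    have := (hg (x + t • v)).hasFDerivAt.comp_hasDerivAt t (hline t)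
    rwa [InnerProductSpace.toDual_apply_apply] at this
  have hq : ∀ t : ℝ, HasDerivAt
      (fun t : ℝ => φ (x + t • v) - t * ⟪g x, v⟫ - L / 2 * t ^ 2 * ‖v‖ ^ 2)
      (⟪g (x + t • v), v⟫ - ⟪g x, v⟫ - L * t * ‖v‖ ^ 2) t := fun t => by
    have h1 := ((hφ t).sub ((hasDerivAt_id t).mul_const ⟪g x, v⟫)).sub
      ((((hasDerivAt_id t).pow 2).const_mul (L / 2)).mul_const (‖v‖ ^ 2))
    exact h1.congr_deriv (by norm_num only [id, pow_one]; ring)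
  have hanti : AntitoneOn (fun t : ℝ => φ (x + t • v) - t * ⟪g x, v⟫ - L / 2 * t ^ 2 * ‖v‖ ^ 2)
      (Set.Icc 0 1) := by
    refine antitoneOn_of_deriv_nonpos (convex_Icc 0 1)
      (fun t _ => (hq t).continuousAt.continuousWithinAt)
      (fun t _ => (hq t).differentiableAt.differentiableWithinAt) fun t ht => ?_
    rw [interior_Icc] at ht
    rw [(hq t).deriv, ← inner_sub_left]
    have h1 := real_inner_le_norm (g (x + t • v) - g x) v
    have h2 := hL (x + t • v) x
    rw [add_sub_cancel_left, norm_smul, Real.norm_of_nonneg ht.1.le] at h2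
    nlinarith [mul_le_mul_of_nonneg_right h2 (norm_nonneg v)]
  have := hanti (Set.left_mem_Icc.2 zero_le_one) (Set.right_mem_Icc.2 zero_le_one) zero_le_one
  simp only [one_smul, zero_smul, add_zero, hv, add_sub_cancel] at this
  rw [← hv] at this
  linarith

lemma add_inner_sub_le_of_lipschitz_gradient {φ : E → ℝ} {g : E → E} {L : ℝ}
    (hg : ∀ x, HasGradientAt φ (g x) x) (hL : ∀ x u, ‖g x - g u‖ ≤ L * ‖x - u‖) (x u : E) :
    φ x + ⟪g x, u - x⟫ - L / 2 * ‖u - x‖ ^ 2 ≤ φ u := by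
  have hneg : ∀ x, HasGradientAt (fun x => -φ x) (-g x) x := fun x => by
    rw [hasGradientAt_iff_hasFDerivAt, map_neg]
    exact (hg x).hasFDerivAt.neg
  have := le_add_inner_add_of_lipschitz_gradient (φ := fun x => -φ x) (g := fun x => -g x)
    (L := L) hneg (fun x u => by rw [neg_sub_neg, norm_sub_rev]; exact hL x u) x u
  simp only [inner_neg_left] at this
  linarith

end General

/-! ### Geometry of the box and its projection -/

section Box

variable {ybar : Vec dy}

lemma ybar_nonneg {y : Vec dy} (hy : y ∈ box ybar) (j : Fin dy) : 0 ≤ ybar j :=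
  (hy j).1.trans (hy j).2

lemma zero_mem_box {y : Vec dy} (hy : y ∈ box ybar) : (0 : Vec dy) ∈ box ybar :=
  fun j => ⟨le_rfl, ybar_nonneg hy j⟩

lemma projBox_mem {y : Vec dy} (hy : y ∈ box ybar) (v : Vec dy) : projBox ybar v ∈ box ybar :=
  ((projBox_unique_nearest ybar v _ ⟨y, hy⟩).1 rfl).1

lemma convex_box : Convex ℝ (box ybar) := by
  intro u hu v hv a b ha hb hab j
  have h1 := hu j
  have h2 := hv j
  have e : (a • u + b • v) j = a * u j + b * v j := by simp
  rw [e]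
  refine ⟨add_nonneg (mul_nonneg ha h1.1) (mul_nonneg hb h2.1), ?_⟩
  calc a * u j + b * v j ≤ a * ybar j + b * ybar j :=
        add_le_add (mul_le_mul_of_nonneg_left h1.2 ha) (mul_le_mul_of_nonneg_left h2.2 hb)
    _ = ybar j := by rw [← add_mul, hab, one_mul]

lemma norm_sub_le_of_mem_box {u v : Vec dy} (hu : u ∈ box ybar) (hv : v ∈ box ybar) :
    ‖u - v‖ ≤ ‖ybar‖ := by
  refine le_of_sq_le_sq ?_ (norm_nonneg _)
  rw [EuclideanSpace.real_norm_sq_eq, EuclideanSpace.real_norm_sq_eq]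
  refine Finset.sum_le_sum fun j _ => sq_le_sq' ?_ ?_
  · have := hu j; have := hv j; simp; linarith
  · have := hu j; have := hv j; simp; linarith

lemma isCompact_box : IsCompact (box ybar) := by
  refine Metric.isCompact_of_isClosed_isBounded ?_ ?_
  · have : box ybar = ⋂ j, {y : Vec dy | 0 ≤ y j} ∩ {y : Vec dy | y j ≤ ybar j} := by
      ext y; simp [box]
    rw [this]
    exact isClosed_iInter fun j => (isClosed_le continuous_const (by fun_prop)).inter
      (isClosed_le (by fun_prop) continuous_const)
  · refine Metric.isBounded_iff.2 ⟨‖ybar‖, fun u hu v hv => ?_⟩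
    rw [dist_eq_norm]
    exact norm_sub_le_of_mem_box hu hv

/-- The variational inequality for the projection onto the box. -/
lemma inner_projBox_le {u : Vec dy} (hu : u ∈ box ybar) (v : Vec dy) :
    ⟪v - projBox ybar v, u - projBox ybar v⟫ ≤ 0 := by
  rw [PiLp.inner_apply]
  refine Finset.sum_nonpos fun j _ => ?_
  have h1 := hu j
  have h2 := ybar_nonneg hu j
  have e : ⟪(v - projBox ybar v) j, (u - projBox ybar v) j⟫
      = (u j - max 0 (min (ybar j) (v j))) * (v j - max 0 (min (ybar j) (v j))) := by
    simp [projBox]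
  rw [e]
  rcases le_total (ybar j) (v j) with h | h
  · rw [min_eq_left h, max_eq_right h2]
    exact mul_nonpos_of_nonpos_of_nonneg (by linarith) (by linarith)
  · rw [min_eq_right h]
    rcases le_total 0 (v j) with h' | h'
    · rw [max_eq_right h']; simp
    · rw [max_eq_left h']
      exact mul_nonpos_of_nonneg_of_nonpos (by linarith) (by linarith)

/-- The variational inequality tested at y gives ‖y − q‖² ≤ −⟪w, y − q⟫; conclude by Cauchy–Schwarz.
-/
lemma norm_sub_projBox_add_le {y : Vec dy} (hy : y ∈ box ybar) (w : Vec dy) :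
    ‖y - projBox ybar (y + w)‖ ≤ ‖w‖ := by
  set q := projBox ybar (y + w) with hq
  have h := inner_projBox_le hy (y + w)
  rw [← hq, add_sub_right_comm, inner_add_left, real_inner_self_eq_norm_sq] at h
  have h2 := neg_le_of_abs_le (abs_real_inner_le_norm w (y - q))
  by_contra! hlt
  nlinarith [norm_nonneg w]

end Box

/-! ### The smoothed function and its minimizer in x -/

section Lagrangian

variable {h : Vec dx → ℝ} {c : Vec dx → Vec dy} {ybar : Vec dy} {L p : ℝ}

lemma lagr_eq_inner (x : Vec dx) (y : Vec dy) : lagr h c x y = h x + ⟪c x, y⟫ := by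
  simp [lagr, PiLp.inner_apply]

lemma lagr_sub_lagr (x : Vec dx) (y y' : Vec dy) :
    lagr h c x y' - lagr h c x y = ⟪c x, y' - y⟫ := by
  rw [lagr_eq_inner, lagr_eq_inner, inner_sub_right]; ring

/-- The proximal term cancels and f is affine in y, so increments in y are exact, with slope
independent of y and z. -/
lemma smoothed_sub_smoothed (z x : Vec dx) (y y' : Vec dy) :
    smoothed (lagr h c) p z x y' - smoothed (lagr h c) p z x y = ⟪c x, y' - y⟫ := by
  rw [← lagr_sub_lagr (h := h)]; simp only [smoothed]; ring

lemma hasGradientAt_lagr (x : Vec dx) (y : Vec dy) :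
    HasGradientAt (fun v => lagr h c x v) (c x) y := by
  rw [hasGradientAt_iff_hasFDerivAt]
  have := ((InnerProductSpace.toDual ℝ (Vec dy)) (c x)).hasFDerivAt (x := y)
  refine (this.const_add (h x)).congr_of_eventuallyEq (Filter.Eventually.of_forall fun v => ?_)
  simp [lagr_eq_inner]

lemma gradY_lagr (x : Vec dx) (y : Vec dy) : gradY (lagr h c) x y = c x :=
  (hasGradientAt_lagr x y).gradient

lemma gradY_smoothed (z x : Vec dx) (y : Vec dy) :
    gradY (smoothed (lagr h c) p z) x y = c x := by
  refine HasGradientAt.gradient (f := fun v => smoothed (lagr h c) p z x v) ?_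
  rw [hasGradientAt_iff_hasFDerivAt]
  exact (hasGradientAt_lagr x y).hasFDerivAt.add_const _

lemma IsLSmooth.hasGradientAt {f : Vec dx → Vec dy → ℝ} (hf : IsLSmooth f ybar L)
    {y : Vec dy} (hy : y ∈ box ybar) (x : Vec dx) :
    HasGradientAt (fun u => f u y) (gradX f x y) x := by
  have h1 : DifferentiableAt ℝ (fun u : Vec dx => (u, y)) x := by fun_prop
  have h2 : DifferentiableAt ℝ ((fun q : Vec dx × Vec dy => f q.1 q.2) ∘ fun u => (u, y)) x :=
    (hf.differentiable x y hy).comp x h1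
  exact h2.hasGradientAt

lemma norm_fst_le {E F : Type*} [SeminormedAddCommGroup E] [SeminormedAddCommGroup F]
    (q : WithLp 2 (E × F)) : ‖q.fst‖ ≤ ‖q‖ := by
  refine le_of_sq_le_sq ?_ (norm_nonneg _)
  rw [WithLp.prod_norm_sq_eq_of_L2]; nlinarith [sq_nonneg ‖q.snd‖]

lemma norm_snd_le {E F : Type*} [SeminormedAddCommGroup E] [SeminormedAddCommGroup F]
    (q : WithLp 2 (E × F)) : ‖q.snd‖ ≤ ‖q‖ := by
  refine le_of_sq_le_sq ?_ (norm_nonneg _)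
  rw [WithLp.prod_norm_sq_eq_of_L2]; nlinarith [sq_nonneg ‖q.fst‖]

lemma IsLSmooth.norm_gradX_sub_le {f : Vec dx → Vec dy → ℝ} (hf : IsLSmooth f ybar L)
    {y₁ y₂ : Vec dy} (hy₁ : y₁ ∈ box ybar) (hy₂ : y₂ ∈ box ybar) (x₁ x₂ : Vec dx) :
    ‖gradX f x₁ y₁ - gradX f x₂ y₂‖ ≤ L * (‖x₁ - x₂‖ + ‖y₁ - y₂‖) :=
  (norm_fst_le (gradXY f x₁ y₁ - gradXY f x₂ y₂)).trans (hf.lipschitz x₁ x₂ y₁ hy₁ y₂ hy₂)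

lemma IsLSmooth.norm_c_sub_le (hf : IsLSmooth (lagr h c) ybar L) {y : Vec dy}
    (hy : y ∈ box ybar) (x₁ x₂ : Vec dx) : ‖c x₁ - c x₂‖ ≤ L * ‖x₁ - x₂‖ := by
  have := (norm_snd_le (gradXY (lagr h c) x₁ y - gradXY (lagr h c) x₂ y)).trans
    (hf.lipschitz x₁ x₂ y hy y hy)
  simpa [gradXY, gradY_lagr] using this

/-- The gradient of the smoothed function in `x`. -/
def gradK (f : Vec dx → Vec dy → ℝ) (p : ℝ) (z x : Vec dx) (y : Vec dy) : Vec dx :=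
  gradX f x y + p • (x - z)

variable {f : Vec dx → Vec dy → ℝ}

lemma norm_sub_sq_expand (z x u : Vec dx) :
    ‖u - z‖ ^ 2 = ‖x - z‖ ^ 2 + 2 * ⟪x - z, u - x⟫ + ‖u - x‖ ^ 2 := by
  rw [← norm_add_sq_real]; congr 2; abel

lemma IsLSmooth.smoothed_le (hf : IsLSmooth f ybar L) {y : Vec dy} (hy : y ∈ box ybar)
    (z x u : Vec dx) :
    smoothed f p z u y ≤ smoothed f p z x y + ⟪gradK f p z x y, u - x⟫
      + (p + L) / 2 * ‖u - x‖ ^ 2 := by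
  have h1 := le_add_inner_add_of_lipschitz_gradient (hf.hasGradientAt hy) (L := L)
    (fun a b => by simpa using hf.norm_gradX_sub_le hy hy a b) x u
  simp only [smoothed, gradK, inner_add_left, inner_smul_left, RCLike.conj_to_real,
    norm_sub_sq_expand z x u]
  linarith

/-- Nonconvexity of f costs curvature at most L while the proximal term supplies p: this is strong
convexity of modulus p − L once p > L. -/
lemma IsLSmooth.le_smoothed (hf : IsLSmooth f ybar L) {y : Vec dy} (hy : y ∈ box ybar)
    (z x u : Vec dx) :
    smoothed f p z x y + ⟪gradK f p z x y, u - x⟫ + (p - L) / 2 * ‖u - x‖ ^ 2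
      ≤ smoothed f p z u y := by
  have h1 := add_inner_sub_le_of_lipschitz_gradient (hf.hasGradientAt hy) (L := L)
    (fun a b => by simpa using hf.norm_gradX_sub_le hy hy a b) x u
  simp only [smoothed, gradK, inner_add_left, inner_smul_left, RCLike.conj_to_real,
    norm_sub_sq_expand z x u]
  linarith

lemma IsLSmooth.le_inner_gradK_sub (hf : IsLSmooth f ybar L) {y : Vec dy} (hy : y ∈ box ybar)
    (z x u : Vec dx) :
    (p - L) * ‖x - u‖ ^ 2 ≤ ⟪gradK f p z x y - gradK f p z u y, x - u⟫ := by
  have h1 := hf.le_smoothed (p := p) hy z x u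
  have h2 := hf.le_smoothed (p := p) hy z u x
  rw [norm_sub_rev u x, ← neg_sub x u, inner_neg_right] at h1
  rw [inner_sub_left]
  linarith

lemma IsLSmooth.continuous_smoothed (hf : IsLSmooth f ybar L) {y : Vec dy} (hy : y ∈ box ybar)
    (z : Vec dx) : Continuous fun x => smoothed f p z x y := by
  have h1 : Continuous fun x => f x y :=
    continuous_iff_continuousAt.2 fun x => (hf.hasGradientAt hy x).continuousAt
  simp only [smoothed]
  fun_prop

/-- Strong convexity makes the function coercive: outside the ball of radius 2‖g‖/(p − L) it exceeds
its value at 0. -/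
lemma IsLSmooth.exists_isMin (hf : IsLSmooth f ybar L) (hpL : L < p) {y : Vec dy}
    (hy : y ∈ box ybar) (z : Vec dx) :
    ∃ x, ∀ u, smoothed f p z x y ≤ smoothed f p z u y := by
  set g := gradK f p z 0 y
  have hlow : ∀ u, smoothed f p z 0 y + ‖u‖ * ((p - L) / 2 * ‖u‖ - ‖g‖) ≤ smoothed f p z u y := by
    intro u
    have h1 := hf.le_smoothed (p := p) hy z 0 u
    rw [sub_zero] at h1
    have h2 := neg_le_of_abs_le (abs_real_inner_le_norm g u)
    nlinarith
  refine (hf.continuous_smoothed hy z).exists_forall_le' 0 ?_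
  have hpos : 0 < (p - L) / 2 := by linarith
  filter_upwards [tendsto_norm_cocompact_atTop.eventually_ge_atTop (‖g‖ / ((p - L) / 2))]
    with u hu
  rw [div_le_iff₀ hpos] at hu
  refine le_trans ?_ (hlow u)
  have := mul_nonneg (norm_nonneg u) (sub_nonneg.2 (hu.trans_eq (mul_comm _ _)))
  linarith

/-- The minimizer of the smoothed function in `x`. -/
def argminX (f : Vec dx → Vec dy → ℝ) (p : ℝ) (z : Vec dx) (y : Vec dy) : Vec dx :=
  Classical.epsilon fun x => ∀ u, smoothed f p z x y ≤ smoothed f p z u y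

/-- The dual function `d(y, z) = min_x K(x, y; z)`. -/
def dual (f : Vec dx → Vec dy → ℝ) (p : ℝ) (z : Vec dx) (y : Vec dy) : ℝ :=
  smoothed f p z (argminX f p z y) y

lemma IsLSmooth.dual_le (hf : IsLSmooth f ybar L) (hpL : L < p) {y : Vec dy}
    (hy : y ∈ box ybar) (z u : Vec dx) : dual f p z y ≤ smoothed f p z u y :=
  Classical.epsilon_spec (hf.exists_isMin hpL hy z) u

lemma IsLSmooth.gradK_argminX (hf : IsLSmooth f ybar L) (hpL : L < p) {y : Vec dy}
    (hy : y ∈ box ybar) (z : Vec dx) : gradK f p z (argminX f p z y) y = 0 := by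
  set g := gradK f p z (argminX f p z y) y with hg
  set a := argminX f p z y
  by_contra hne
  have hgpos : 0 < ‖g‖ ^ 2 := by positivity
  have hp : 0 < |p + L| + 1 := by positivity
  -- A gradient step this short would strictly lower the function if the gradient were nonzero. The
  -- absolute value is there because only L < p is assumed, so p + L may have any sign.
  set t := 1 / (|p + L| + 1) with ht
  have htpos : 0 < t := by positivity
  have h1 := hf.smoothed_le (p := p) hy z a (a - t • g)
  have h2 := hf.dual_le hpL hy z (a - t • g)
  have e : a - t • g - a = -(t • g) := by abel
  rw [e, inner_neg_right, inner_smul_right, ← hg, real_inner_self_eq_norm_sq, norm_neg,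
    norm_smul, Real.norm_of_nonneg htpos.le] at h1
  have h3 : dual f p z y = smoothed f p z a y := rfl
  have h4 : t * (|p + L| + 1) = 1 := by rw [ht]; field_simp
  have h5 : (p + L) * t ≤ 1 := by nlinarith [le_abs_self (p + L)]
  have h6 : t * ‖g‖ ^ 2 ≤ (p + L) / 2 * (t * ‖g‖) ^ 2 := by linarith
  have h7 : (p + L) / 2 * (t * ‖g‖) ^ 2 = ((p + L) * t) * (t * ‖g‖ ^ 2) / 2 := by ring
  have h8 : 0 < t * ‖g‖ ^ 2 := by positivity
  nlinarith

lemma IsLSmooth.dual_add_sq_le (hf : IsLSmooth f ybar L) (hpL : L < p) {y : Vec dy}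
    (hy : y ∈ box ybar) (z u : Vec dx) :
    dual f p z y + (p - L) / 2 * ‖u - argminX f p z y‖ ^ 2 ≤ smoothed f p z u y := by
  have := hf.le_smoothed (p := p) hy z (argminX f p z y) u
  rw [hf.gradK_argminX hpL hy, inner_zero_left, add_zero] at this
  exact this

/-- Primal error bound: strong monotonicity of the gradient, which vanishes at the minimizer, and
Cauchy–Schwarz. -/
lemma IsLSmooth.norm_sub_argminX_le (hf : IsLSmooth f ybar L) (hpL : L < p) {y : Vec dy}
    (hy : y ∈ box ybar) (z x : Vec dx) :
    (p - L) * ‖x - argminX f p z y‖ ≤ ‖gradK f p z x y‖ := by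
  have h1 := hf.le_inner_gradK_sub (p := p) hy z x (argminX f p z y)
  rw [hf.gradK_argminX hpL hy, sub_zero] at h1
  have h2 := real_inner_le_norm (gradK f p z x y) (x - argminX f p z y)
  rcases (norm_nonneg (x - argminX f p z y)).eq_or_lt with h0 | h0
  · rw [← h0, mul_zero]; exact norm_nonneg _
  · nlinarith

/-- At the minimizer for y, the gradient for y' reduces to a difference of two values of ∇ₓ f, so
the primal error bound applies. -/
lemma IsLSmooth.norm_argminX_sub_le (hf : IsLSmooth f ybar L) (hpL : L < p) {y y' : Vec dy}
    (hy : y ∈ box ybar) (hy' : y' ∈ box ybar) (z : Vec dx) :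
    (p - L) * ‖argminX f p z y - argminX f p z y'‖ ≤ L * ‖y - y'‖ := by
  refine (hf.norm_sub_argminX_le hpL hy' z (argminX f p z y)).trans ?_
  have h1 : gradK f p z (argminX f p z y) y'
      = gradX f (argminX f p z y) y' - gradX f (argminX f p z y) y := by
    have := hf.gradK_argminX hpL hy z
    rw [gradK] at this ⊢
    rw [eq_neg_of_add_eq_zero_left this, sub_neg_eq_add]
  rw [h1]
  have := hf.norm_gradX_sub_le hy' hy (argminX f p z y) (argminX f p z y)
  rwa [sub_self, norm_zero, zero_add, norm_sub_rev y' y] at this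

lemma IsLSmooth.norm_argminX_sub_le_center (hf : IsLSmooth f ybar L) (hpL : L < p) (hp : 0 ≤ p)
    {y : Vec dy} (hy : y ∈ box ybar) (z z' : Vec dx) :
    (p - L) * ‖argminX f p z y - argminX f p z' y‖ ≤ p * ‖z - z'‖ := by
  refine (hf.norm_sub_argminX_le hpL hy z' (argminX f p z y)).trans ?_
  have h1 : gradK f p z' (argminX f p z y) y = p • (z - z') := by
    have h2 : gradK f p z' (argminX f p z y) y
        = gradK f p z (argminX f p z y) y + p • (z - z') := by
      simp only [gradK, smul_sub]; abel
    rw [h2, hf.gradK_argminX hpL hy, zero_add]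
  rw [h1, norm_smul, Real.norm_of_nonneg hp]

end Lagrangian
-- The dual function, saddle points and the potential
section Saddle

variable {h : Vec dx → ℝ} {c : Vec dx → Vec dy} {ybar : Vec dy} {L p : ℝ}

/-- Supergradient inequality for the concave dual: the minimizer at y' is a competitor in the
problem defining the dual value at y. -/
lemma IsLSmooth.inner_le_dual_sub_dual (hf : IsLSmooth (lagr h c) ybar L) (hpL : L < p)
    {y : Vec dy} (hy : y ∈ box ybar) (y' : Vec dy) (z : Vec dx) :
    ⟪c (argminX (lagr h c) p z y'), y' - y⟫ ≤ dual (lagr h c) p z y' - dual (lagr h c) p z y := by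
  rw [← smoothed_sub_smoothed (h := h) (p := p) z]
  exact sub_le_sub_left (hf.dual_le hpL hy z _) _

lemma IsLSmooth.continuousOn_dual (hf : IsLSmooth (lagr h c) ybar L) (hpL : L < p) (z : Vec dx) :
    ContinuousOn (dual (lagr h c) p z) (box ybar) := by
  intro y₀ hy₀
  have hm : 0 < p - L := sub_pos.2 hpL
  have ha : ContinuousOn (argminX (lagr h c) p z) (box ybar) := by
    refine LipschitzOnWith.continuousOn (K := (L / (p - L)).toNNReal)
      (LipschitzOnWith.of_dist_le_mul fun y hy y' hy' => ?_)
    rw [dist_eq_norm, dist_eq_norm]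
    have h1 := hf.norm_argminX_sub_le hpL hy hy' z
    calc _ ≤ L / (p - L) * ‖y - y'‖ := by
          rw [div_mul_eq_mul_div, le_div_iff₀ hm, mul_comm]; exact h1
      _ ≤ _ := mul_le_mul_of_nonneg_right (Real.le_coe_toNNReal _) (norm_nonneg _)
  -- Smoothness of f is known only for y in the box; 0 lies there, and f(·, 0) = h.
  have hh : Continuous h := by
    have h1 : Continuous fun x => lagr h c x 0 := continuous_iff_continuousAt.2 fun x =>
      (hf.hasGradientAt (zero_mem_box hy₀) x).continuousAt
    simpa [lagr] using h1
  have hc : Continuous c := by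
    refine LipschitzWith.continuous (K := L.toNNReal) (LipschitzWith.of_dist_le_mul fun a b => ?_)
    rw [dist_eq_norm, dist_eq_norm]
    exact (hf.norm_c_sub_le hy₀ a b).trans
      (mul_le_mul_of_nonneg_right (Real.le_coe_toNNReal _) (norm_nonneg _))
  have : ContinuousOn (fun y => h (argminX (lagr h c) p z y)
      + ⟪c (argminX (lagr h c) p z y), y⟫ + p / 2 * ‖argminX (lagr h c) p z y - z‖ ^ 2)
      (box ybar) := by fun_prop
  refine (this.congr fun y _ => ?_) y₀ hy₀
  rw [dual, smoothed, lagr_eq_inner]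

/-- A maximizer of the dual function over the box. -/
def argmaxY (f : Vec dx → Vec dy → ℝ) (ybar : Vec dy) (p : ℝ) (z : Vec dx) : Vec dy :=
  Classical.epsilon fun y => y ∈ box ybar ∧ ∀ v ∈ box ybar, dual f p z v ≤ dual f p z y

/-- The proximal function `P(z) = max_{y ∈ 𝒴} d(y, z)`. -/
def primal (f : Vec dx → Vec dy → ℝ) (ybar : Vec dy) (p : ℝ) (z : Vec dx) : ℝ :=
  dual f p z (argmaxY f ybar p z)

lemma IsLSmooth.argmaxY_spec (hf : IsLSmooth (lagr h c) ybar L) (hpL : L < p)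
    (hne : (box ybar).Nonempty) (z : Vec dx) :
    argmaxY (lagr h c) ybar p z ∈ box ybar ∧
      ∀ v ∈ box ybar, dual (lagr h c) p z v ≤ primal (lagr h c) ybar p z := by
  obtain ⟨y, hy, hmax⟩ := isCompact_box.exists_isMaxOn hne (hf.continuousOn_dual hpL z)
  exact Classical.epsilon_spec (p := fun y => y ∈ box ybar ∧ ∀ v ∈ box ybar,
    dual (lagr h c) p z v ≤ dual (lagr h c) p z y) ⟨y, hy, fun v hv => hmax hv⟩

/-- At a dual maximizer the primal minimizer and the maximizer form a saddle point. -/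
lemma IsLSmooth.inner_argmaxY_le (hf : IsLSmooth (lagr h c) ybar L) (hL : 0 ≤ L) (hpL : L < p)
    {y : Vec dy} (hy : y ∈ box ybar) (z : Vec dx) :
    ⟪c (argminX (lagr h c) p z (argmaxY (lagr h c) ybar p z)),
      y - argmaxY (lagr h c) ybar p z⟫ ≤ 0 := by
  obtain ⟨hs, hmax⟩ := hf.argmaxY_spec hpL ⟨y, hy⟩ z
  set s := argmaxY (lagr h c) ybar p z with hsdef
  set a := argminX (lagr h c) p z
  have hm : 0 < p - L := sub_pos.2 hpL
  -- Maximality along the segment towards y gives the desired sign with c evaluated at the minimizer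
  -- for s + t(y − s); returning to the minimizer for s costs O(t).
  have key : ∀ t : ℝ, 0 < t → t ≤ 1 → (p - L) * ⟪c (a s), y - s⟫ ≤ L ^ 2 * ‖y - s‖ ^ 2 * t := by
    intro t ht ht1
    have hyt : s + t • (y - s) ∈ box ybar :=
      convex_box.add_smul_sub_mem hs hy ⟨ht.le, ht1⟩
    have h1 := hf.inner_le_dual_sub_dual hpL hs (s + t • (y - s)) z
    have h2 := hmax _ hyt
    rw [add_sub_cancel_left, inner_smul_right] at h1
    have h3 : t * ⟪c (a (s + t • (y - s))), y - s⟫ ≤ 0 := h1.trans (sub_nonpos.2 h2)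
    have h4 : ⟪c (a (s + t • (y - s))), y - s⟫ ≤ 0 := nonpos_of_mul_nonpos_right h3 ht
    have h5 : ⟪c (a s), y - s⟫ ≤ L * ‖a s - a (s + t • (y - s))‖ * ‖y - s‖ := by
      have h6 := real_inner_le_norm (c (a s) - c (a (s + t • (y - s)))) (y - s)
      rw [inner_sub_left] at h6
      have h7 := mul_le_mul_of_nonneg_right
        (hf.norm_c_sub_le hy (a s) (a (s + t • (y - s)))) (norm_nonneg (y - s))
      linarith
    have h8 := hf.norm_argminX_sub_le hpL hs hyt z
    rw [← norm_neg (s - _), neg_sub, add_sub_cancel_left, norm_smul, Real.norm_of_nonneg ht.le]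
      at h8
    calc (p - L) * ⟪c (a s), y - s⟫
        ≤ (p - L) * (L * ‖a s - a (s + t • (y - s))‖ * ‖y - s‖) :=
          mul_le_mul_of_nonneg_left h5 hm.le
      _ = L * ‖y - s‖ * ((p - L) * ‖a s - a (s + t • (y - s))‖) := by ring
      _ ≤ L * ‖y - s‖ * (L * (t * ‖y - s‖)) := mul_le_mul_of_nonneg_left h8 (by positivity)
      _ = _ := by ring
  by_contra! hpos
  have hq : 0 < (p - L) * ⟪c (a s), y - s⟫ := mul_pos hm hpos
  set q := (p - L) * ⟪c (a s), y - s⟫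
  set A := L ^ 2 * ‖y - s‖ ^ 2
  have hA : 0 ≤ A := by positivity
  have h1 := key 1 one_pos le_rfl
  have hA' : 0 < A := by linarith
  -- This t turns the bound into q ≤ q/2. It is admissible because the case t = 1 gave q ≤ A.
  have h2 := key (q / (2 * A)) (by positivity) (by rw [div_le_one (by positivity)]; linarith)
  have h3 : A * (q / (2 * A)) = q / 2 := by field_simp
  linarith

lemma bddAbove_lagr (x : Vec dx) : BddAbove (lagr h c x '' box ybar) := by
  refine (isCompact_box.image ?_).bddAbove
  exact continuous_iff_continuousAt.2 fun y => (hasGradientAt_lagr x y).continuousAt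

lemma lagr_le_Phi (x : Vec dx) {y : Vec dy} (hy : y ∈ box ybar) :
    lagr h c x y ≤ Phi (lagr h c) ybar x :=
  le_csSup (bddAbove_lagr x) ⟨y, hy, rfl⟩

/-- At the saddle point x*, the dual maximizer also maximizes f(x*, ·), so Φ(x*) is at most P(z),
the difference being the nonnegative proximal term. -/
lemma IsLSmooth.le_primal (hf : IsLSmooth (lagr h c) ybar L) (hL : 0 ≤ L) (hpL : L < p)
    (hne : (box ybar).Nonempty) {flow : ℝ} (hflow : ∀ x, flow ≤ Phi (lagr h c) ybar x)
    (z : Vec dx) : flow ≤ primal (lagr h c) ybar p z := by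
  refine (hflow (argminX (lagr h c) p z (argmaxY (lagr h c) ybar p z))).trans ?_
  refine csSup_le (hne.image _) ?_
  rintro _ ⟨y, hy, rfl⟩
  have h1 := hf.inner_argmaxY_le hL hpL hy z
  rw [← lagr_sub_lagr (h := h)] at h1
  rw [primal, dual, smoothed]
  have : 0 ≤ p / 2 * ‖argminX (lagr h c) p z (argmaxY (lagr h c) ybar p z) - z‖ ^ 2 := by
    have : 0 ≤ p := hL.trans hpL.le
    positivity
  linarith

/-- The potential function `K(x, y; z) - 2 d(y, z) + 2 P(z)`. -/
def potential (f : Vec dx → Vec dy → ℝ) (ybar : Vec dy) (p : ℝ) (s : State dx dy) : ℝ :=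
  smoothed f p s.z s.x s.y - 2 * dual f p s.z s.y + 2 * primal f ybar p s.z

/-- Write the potential as (K − d) + (P − d) + P; the first two terms are nonnegative. -/
lemma IsLSmooth.le_potential (hf : IsLSmooth (lagr h c) ybar L) (hL : 0 ≤ L) (hpL : L < p)
    {flow : ℝ} (hflow : ∀ x, flow ≤ Phi (lagr h c) ybar x) (s : State dx dy)
    (hs : s.y ∈ box ybar) : flow ≤ potential (lagr h c) ybar p s := by
  have h1 := hf.le_primal hL hpL ⟨_, hs⟩ hflow s.z
  have h2 := hf.dual_le hpL hs s.z s.x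
  have h3 := (hf.argmaxY_spec hpL ⟨_, hs⟩ s.z).2 _ hs
  rw [potential]
  linarith

lemma IsLSmooth.potential_init_le (hf : IsLSmooth (lagr h c) ybar L) (hpL : L < p)
    (x₀ : Vec dx) {y₀ : Vec dy} (hy₀ : y₀ ∈ box ybar) :
    potential (lagr h c) ybar p ⟨x₀, y₀, x₀⟩ ≤ Phi (lagr h c) ybar x₀
      + 2 * (‖gradXY (lagr h c) x₀ y₀‖ * ‖ybar‖) + ‖gradXY (lagr h c) x₀ y₀‖ ^ 2 / (p - L) := by
  have hm : 0 < p - L := sub_pos.2 hpL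
  set G := ‖gradXY (lagr h c) x₀ y₀‖
  have hsm : ∀ y, smoothed (lagr h c) p x₀ x₀ y = lagr h c x₀ y := fun y => by simp [smoothed]
  have hgx : ‖gradK (lagr h c) p x₀ x₀ y₀‖ ≤ G := by
    rw [gradK, sub_self, smul_zero, add_zero]
    exact norm_fst_le (gradXY (lagr h c) x₀ y₀)
  have hgy : ‖c x₀‖ ≤ G := by
    rw [← gradY_lagr (h := h) (c := c) x₀ y₀]
    exact norm_snd_le (gradXY (lagr h c) x₀ y₀)
  have h1 : primal (lagr h c) ybar p x₀ ≤ Phi (lagr h c) ybar x₀ := by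
    have hs := (hf.argmaxY_spec hpL ⟨_, hy₀⟩ x₀).1
    refine (hf.dual_le hpL hs x₀ x₀).trans ?_
    rw [hsm]
    exact lagr_le_Phi x₀ hs
  have h2 : Phi (lagr h c) ybar x₀ ≤ lagr h c x₀ y₀ + G * ‖ybar‖ := by
    refine csSup_le (Set.Nonempty.image _ ⟨_, hy₀⟩) ?_
    rintro _ ⟨y, hy, rfl⟩
    have h3 := lagr_sub_lagr (h := h) (c := c) x₀ y₀ y
    have h4 := real_inner_le_norm (c x₀) (y - y₀)
    have h5 := mul_le_mul hgy (norm_sub_le_of_mem_box hy hy₀) (norm_nonneg _)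
      ((norm_nonneg _).trans hgy)
    linarith
  have h3 : lagr h c x₀ y₀ - G ^ 2 / (2 * (p - L)) ≤ dual (lagr h c) p x₀ y₀ := by
    have h4 := hf.le_smoothed (p := p) hy₀ x₀ x₀ (argminX (lagr h c) p x₀ y₀)
    rw [hsm] at h4
    set v := argminX (lagr h c) p x₀ y₀ - x₀
    have h5 := neg_le_of_abs_le (abs_real_inner_le_norm (gradK (lagr h c) p x₀ x₀ y₀) v)
    have h6 := mul_le_mul_of_nonneg_right hgx (norm_nonneg v)
    have h7 : G * ‖v‖ ≤ (p - L) / 2 * ‖v‖ ^ 2 + G ^ 2 / (2 * (p - L)) := by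
      have h8 : 0 ≤ (p - L) / 2 * (‖v‖ - G / (p - L)) ^ 2 := by positivity
      have h9 : (p - L) / 2 * (‖v‖ - G / (p - L)) ^ 2
          = (p - L) / 2 * ‖v‖ ^ 2 - G * ‖v‖ + G ^ 2 / (2 * (p - L)) := by field_simp; ring
      linarith
    rw [dual]
    linarith
  have h4 : G ^ 2 / (2 * (p - L)) = G ^ 2 / (p - L) / 2 := by field_simp
  have h5 := lagr_le_Phi (h := h) (c := c) x₀ hy₀
  simp only [potential, hsm]
  linarith

end Saddle

/-! ### Moving the proximal centre, and the dual error bound -/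

section Descent

variable {h : Vec dx → ℝ} {c : Vec dx → Vec dy} {ybar : Vec dy} {L p : ℝ}

/-- The change of the potential caused by moving the proximal centre. -/
lemma IsLSmooth.potential_move_center_le (hf : IsLSmooth (lagr h c) ybar L) (hpL : L < p)
    (x' : Vec dx) {y' : Vec dy} (hy' : y' ∈ box ybar) (z : Vec dx) (γ : ℝ) :
    potential (lagr h c) ybar p ⟨x', y', γ • x' + (1 - γ) • z⟩
      ≤ potential (lagr h c) ybar p ⟨x', y', z⟩ - p / 2 * (γ * (2 - γ)) * ‖x' - z‖ ^ 2
        + 2 * p * γ * ⟪x' - z, argminX (lagr h c) p (γ • x' + (1 - γ) • z) y'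
            - argminX (lagr h c) p z (argmaxY (lagr h c) ybar p (γ • x' + (1 - γ) • z))⟫ := by
  set z' := γ • x' + (1 - γ) • z with hz'
  obtain ⟨hs, -⟩ := hf.argmaxY_spec hpL ⟨_, hy'⟩ z'
  set s := argmaxY (lagr h c) ybar p z'
  have hd : z' - z = γ • (x' - z) := by rw [hz']; module
  have hsq : ∀ u : Vec dx, ‖u - z'‖ ^ 2 = ‖u - z‖ ^ 2 - 2 * γ * ⟪x' - z, u - z⟫
      + γ ^ 2 * ‖x' - z‖ ^ 2 := fun u => by
    have : u - z' = (u - z) - γ • (x' - z) := by rw [← hd]; abel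
    rw [this, norm_sub_sq_real, inner_smul_right, norm_smul, mul_pow, Real.norm_eq_abs, sq_abs,
      real_inner_comm]
    ring
  have hK : ∀ u y, smoothed (lagr h c) p z' u y = smoothed (lagr h c) p z u y
      - p * γ * ⟪x' - z, u - z⟫ + p / 2 * γ ^ 2 * ‖x' - z‖ ^ 2 := fun u y => by
    simp only [smoothed, hsq]; ring
  -- Here the new minimizer competes in the old problem; for P below, the old minimizer at the new
  -- dual maximizer competes in the new problem. This is why the final inner product mixes both
  -- centres.
  have h1 : dual (lagr h c) p z y' - p * γ * ⟪x' - z, argminX (lagr h c) p z' y' - z⟫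
      + p / 2 * γ ^ 2 * ‖x' - z‖ ^ 2 ≤ dual (lagr h c) p z' y' := by
    have h2 := hf.dual_le hpL hy' z (argminX (lagr h c) p z' y')
    rw [dual.eq_1 _ p z', hK]
    linarith
  have h2 : primal (lagr h c) ybar p z' ≤ primal (lagr h c) ybar p z
      - p * γ * ⟪x' - z, argminX (lagr h c) p z s - z⟫ + p / 2 * γ ^ 2 * ‖x' - z‖ ^ 2 := by
    have h3 := hf.dual_le hpL hs z' (argminX (lagr h c) p z s)
    have h4 : dual (lagr h c) p z s ≤ primal (lagr h c) ybar p z :=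
      (hf.argmaxY_spec hpL ⟨_, hy'⟩ z).2 _ hs
    rw [hK] at h3
    rw [dual.eq_1 _ p z] at h4
    rw [primal]
    linarith
  have h3 : ⟪x' - z, argminX (lagr h c) p z' y' - argminX (lagr h c) p z s⟫
      = ⟪x' - z, argminX (lagr h c) p z' y' - z⟫ - ⟪x' - z, argminX (lagr h c) p z s - z⟫ := by
    rw [← inner_sub_right]; congr 1; abel
  have h4 := real_inner_self_eq_norm_sq (x' - z)
  simp only [potential, hK, h3, h4]
  linarith

/-- The dual error bound. -/
lemma IsLSmooth.dual_error_bound (hf : IsLSmooth (lagr h c) ybar L) (hL : 0 ≤ L) (hpL : L < p)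
    {β : ℝ} (hβ : 0 < β) (x : Vec dx) {y : Vec dy} (hy : y ∈ box ybar) (z : Vec dx) :
    (p - L) * ‖argminX (lagr h c) p z (projBox ybar (y + β • c x))
        - argminX (lagr h c) p z (argmaxY (lagr h c) ybar p z)‖ ^ 2
      ≤ (‖projBox ybar (y + β • c x) - y‖ / β
        + L * ‖argminX (lagr h c) p z (projBox ybar (y + β • c x)) - x‖) * ‖ybar‖ := by
  obtain ⟨hs, -⟩ := hf.argmaxY_spec hpL ⟨_, hy⟩ z
  have hy' := projBox_mem hy (y + β • c x)
  have hproj := inner_projBox_le hs (y + β • c x)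
  have hsad := hf.inner_argmaxY_le hL hpL hy' z
  set y' := projBox ybar (y + β • c x)
  set s := argmaxY (lagr h c) ybar p z
  set a := argminX (lagr h c) p z y'
  set t := argminX (lagr h c) p z s
  -- Strong convexity at both minimizers, each tested at the other, gives (p − L)‖a − t‖² ≤ ⟪c t, y'
  -- − s⟫ + ⟪c a, s − y'⟫. The saddle inequality discards the first term; in the second, c a is
  -- compared with c x, where the projection inequality applies.
  have h1 := hf.dual_add_sq_le hpL hy' z t
  have h2 := hf.dual_add_sq_le hpL hs z a
  rw [norm_sub_rev] at h1
  have h3 := smoothed_sub_smoothed (h := h) (c := c) (p := p) z t s y'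
  have h4 := smoothed_sub_smoothed (h := h) (c := c) (p := p) z a y' s
  have e1 : dual (lagr h c) p z y' = smoothed (lagr h c) p z a y' := rfl
  have e2 : dual (lagr h c) p z s = smoothed (lagr h c) p z t s := rfl
  have hn : ‖s - y'‖ ≤ ‖ybar‖ := norm_sub_le_of_mem_box hs hy'
  have h5 : ⟪c a - c x, s - y'⟫ ≤ L * ‖a - x‖ * ‖ybar‖ :=
    (real_inner_le_norm _ _).trans (mul_le_mul (hf.norm_c_sub_le hy a x) hn (norm_nonneg _)
      (mul_nonneg hL (norm_nonneg _)))
  have h6 : ⟪c x, s - y'⟫ ≤ ‖y' - y‖ / β * ‖ybar‖ := by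
    have e3 : y + β • c x - y' = β • c x - (y' - y) := by abel
    rw [e3, inner_sub_left, inner_smul_left, RCLike.conj_to_real] at hproj
    have h7 := real_inner_le_norm (y' - y) (s - y')
    have h8 := mul_le_mul_of_nonneg_left hn (norm_nonneg (y' - y))
    rw [div_mul_eq_mul_div, le_div_iff₀ hβ]
    linarith
  rw [inner_sub_left] at h5
  linarith

end Descent
-- The zeroth-order block step
section BlockStep

variable {f : Vec dx → Vec dy → ℝ} {ybar : Vec dy} {L p : ℝ}

lemma sum_smul_basisVec_apply (I : Finset (Fin dx)) (w : Fin dx → ℝ) (j : Fin dx) :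
    (∑ i ∈ I, w i • basisVec i) j = if j ∈ I then w j else 0 := by
  simp [basisVec, Pi.single_apply]

lemma inner_sum_smul_basisVec (I : Finset (Fin dx)) (w : Fin dx → ℝ) (g : Vec dx) :
    ⟪g, ∑ i ∈ I, w i • basisVec i⟫ = ∑ i ∈ I, g i * w i := by
  rw [inner_sum]
  refine Finset.sum_congr rfl fun i _ => ?_
  rw [inner_smul_right, basisVec, EuclideanSpace.inner_single_right]
  simp [mul_comm]

lemma norm_sq_sum_smul_basisVec (I : Finset (Fin dx)) (w : Fin dx → ℝ) :
    ‖∑ i ∈ I, w i • basisVec i‖ ^ 2 = ∑ i ∈ I, w i ^ 2 := by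
  rw [← real_inner_self_eq_norm_sq, inner_sum_smul_basisVec]
  refine Finset.sum_congr rfl fun i hi => ?_
  rw [sum_smul_basisVec_apply, if_pos hi, sq]

/-- The `i`-th entry of the zeroth-order estimate of the gradient of the smoothed function. -/
def coordEst (f : Vec dx → Vec dy → ℝ) (p r : ℝ) (x : Vec dx) (y : Vec dy) (z : Vec dx)
    (i : Fin dx) : ℝ :=
  (f (x + r • basisVec i) y - f x y) / r + p * (x i - z i)

lemma blockEst_eq (p r : ℝ) (I : Finset (Fin dx)) (x : Vec dx) (y : Vec dy) (z : Vec dx) :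
    blockEst f p r I x y z = ∑ i ∈ I, coordEst f p r x y z i • basisVec i :=
  Finset.sum_congr rfl fun _ _ => (add_smul _ _ _).symm

/-- The proximal part of the estimate is exact; the two quadratic bounds along r eᵢ confine the
finite-difference error to Lr/2. -/
lemma IsLSmooth.sq_coordEst_sub_le (hf : IsLSmooth f ybar L) {y : Vec dy}
    (hy : y ∈ box ybar) {r : ℝ} (hr : 0 < r) (x z : Vec dx) (i : Fin dx) :
    (coordEst f p r x y z i - gradK f p z x y i) ^ 2 ≤ (L * r / 2) ^ 2 := by
  have hlip : ∀ a b, ‖gradX f a y - gradX f b y‖ ≤ L * ‖a - b‖ := fun a b => by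
    simpa using hf.norm_gradX_sub_le hy hy a b
  have hu := le_add_inner_add_of_lipschitz_gradient (hf.hasGradientAt hy) hlip x
    (x + r • basisVec i)
  have hl := add_inner_sub_le_of_lipschitz_gradient (hf.hasGradientAt hy) hlip x
    (x + r • basisVec i)
  have hn : ‖r • basisVec i‖ = r := by
    rw [norm_smul, basisVec, PiLp.norm_single]; simp [abs_of_pos hr]
  have hi : ⟪gradX f x y, r • basisVec i⟫ = r * gradX f x y i := by
    rw [inner_smul_right, basisVec, EuclideanSpace.inner_single_right]; simp
  rw [add_sub_cancel_left, hn, hi] at hu hl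
  have e : coordEst f p r x y z i - gradK f p z x y i
      = (f (x + r • basisVec i) y - f x y) / r - gradX f x y i := by
    simp only [coordEst, gradK, PiLp.add_apply, PiLp.smul_apply, PiLp.sub_apply, smul_eq_mul]
    ring
  have hr' : (f (x + r • basisVec i) y - f x y) / r * r = f (x + r • basisVec i) y - f x y :=
    div_mul_cancel₀ _ hr.ne'
  rw [e]
  set q := (f (x + r • basisVec i) y - f x y) / r
  refine sq_le_sq' ?_ ?_
  · refine le_of_mul_le_mul_right (?_ : _ * r ≤ _ * r) hr
    linarith
  · refine le_of_mul_le_mul_right (?_ : _ * r ≤ _ * r) hr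
    linarith

/-- The direction is estimated at y but progress is measured at y', which produces the
gradient-shift term. The bound is a sum over the block so that it can later be averaged. -/
lemma IsLSmooth.smoothed_block_step_le (hf : IsLSmooth f ybar L) {y y' : Vec dy}
    (hy : y ∈ box ybar) (hy' : y' ∈ box ybar) {α r : ℝ} (hα : 0 < α) (hαp : α * (p + L) ≤ 1)
    (hr : 0 < r) (I : Finset (Fin dx)) (x z : Vec dx) :
    smoothed f p z (x - α • blockEst f p r I x y z) y' - smoothed f p z x y'
      ≤ ∑ i ∈ I, (-(α / 4) * gradK f p z x y i ^ 2 + α * (L * r / 2) ^ 2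
        + 3 / 2 * α * (gradX f x y' - gradX f x y) i ^ 2) := by
  have h1 := hf.smoothed_le (p := p) hy' z x (x - α • blockEst f p r I x y z)
  rw [sub_sub_cancel_left, inner_neg_right, inner_smul_right, norm_neg, norm_smul, mul_pow,
    Real.norm_eq_abs, sq_abs, blockEst_eq, inner_sum_smul_basisVec, norm_sq_sum_smul_basisVec] at h1
  rw [blockEst_eq]
  set w := coordEst f p r x y z
  set g := gradK f p z x y
  set δ := gradX f x y' - gradX f x y with hδ
  have e : ∀ i, gradK f p z x y' i = g i + δ i := fun i => by
    simp only [g, hδ, gradK, PiLp.add_apply, PiLp.smul_apply, PiLp.sub_apply]; ring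
  have h2 : -(α * ∑ i ∈ I, gradK f p z x y' i * w i) + (p + L) / 2 * (α ^ 2 * ∑ i ∈ I, w i ^ 2)
      ≤ ∑ i ∈ I, (-(α / 4) * g i ^ 2 + α * (L * r / 2) ^ 2 + 3 / 2 * α * δ i ^ 2) := by
    rw [Finset.mul_sum, Finset.mul_sum, Finset.mul_sum, ← Finset.sum_neg_distrib,
      ← Finset.sum_add_distrib]
    refine Finset.sum_le_sum fun i _ => ?_
    rw [e]
    have h3 := hf.sq_coordEst_sub_le (p := p) hy hr x z i
    -- With e = w − g, the step bound reduces this to (α/2)[(e − δ)² − (g + δ)²]; then (e − δ)² ≤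
    -- 2e² + 2δ² and (g + δ)² ≥ g²/2 − δ².
    have h4 : 0 ≤ α * (1 - α * (p + L)) * w i ^ 2 := by
      have := sub_nonneg.2 hαp; positivity
    have h5 := mul_le_mul_of_nonneg_left h3 hα.le
    have h6 : 0 ≤ α * (g i / 2 + δ i) ^ 2 := by positivity
    have h7 : 0 ≤ α * (δ i + (w i - g i)) ^ 2 := by positivity
    linarith
  linarith

lemma IsLSmooth.norm_sq_block_step_le (hf : IsLSmooth f ybar L) {y : Vec dy}
    (hy : y ∈ box ybar) {r : ℝ} (hr : 0 < r) (α : ℝ) (I : Finset (Fin dx)) (x z : Vec dx) :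
    ‖x - α • blockEst f p r I x y z - x‖ ^ 2
      ≤ α ^ 2 * ∑ i ∈ I, (2 * gradK f p z x y i ^ 2 + 2 * (L * r / 2) ^ 2) := by
  rw [sub_sub_cancel_left, norm_neg, norm_smul, mul_pow, Real.norm_eq_abs, sq_abs, blockEst_eq,
    norm_sq_sum_smul_basisVec]
  refine mul_le_mul_of_nonneg_left (Finset.sum_le_sum fun i _ => ?_) (sq_nonneg _)
  have h3 := hf.sq_coordEst_sub_le (p := p) hy hr x z i
  have h4 := sq_nonneg (coordEst f p r x y z i - 2 * gradK f p z x y i)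
  linarith

end BlockStep
-- Change of the potential in one step
section OneStep

/-- Scalar core of the centre move, with B = 1/β, W = ‖x' − z‖, Y the dual move, D the gradient
norm, E the minimizer shift and T the distance from the new minimizer to x. Young's inequality
splits W·E; the error bound makes E² linear in Y, W and D, and each linear term is absorbed by a
square, leaving only multiples of R². -/
lemma center_error_absorb {L p γ R B ρ W Y D E T m : ℝ} (hL : 0 < L) (hp : 3 * L ≤ p)
    (hγ : 0 < γ) (hγ' : γ ≤ 1 / 36) (hR : 0 ≤ R) (hρ : 0 < ρ) (hB : 12 * L ≤ B)
    (hY : 0 ≤ Y) (hm : m = p - L)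
    (hE : m * E ^ 2 ≤ (Y * B + L * T) * R)
    (hT : L * T ≤ 3 / 2 * (L * γ * W) + L / 2 * Y + D / 2) :
    2 * p * γ * (W * (E + 3 / 2 * γ * W)) ≤ p / 2 * (γ * (2 - γ)) * W ^ 2 - p * γ / 2 * W ^ 2
      + Y ^ 2 * B / 8 + ρ / 16 * D ^ 2
      + R ^ 2 * (98 * γ ^ 2 * B + 54 * L * γ ^ 3 + 36 * γ ^ 2 / ρ) := by
  have hp0 : 0 < p := by linarith
  have hB0 : 0 < B := by linarith
  have a1 : 0 ≤ p * γ * (W / 2 - 2 * E) ^ 2 := by positivity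
  -- The condition p ≥ 3L is exactly 4p ≤ 6(p − L).
  have a2 : 4 * p * γ * E ^ 2 ≤ 6 * γ * (m * E ^ 2) := by
    have : 0 ≤ γ * E ^ 2 * (6 * m - 4 * p) := by
      have : 0 ≤ 6 * m - 4 * p := by rw [hm]; linarith
      positivity
    linarith
  have a3 := mul_le_mul_of_nonneg_left hE (by positivity : 0 ≤ 6 * γ)
  have a4 := mul_le_mul_of_nonneg_left hT (by positivity : 0 ≤ 6 * γ * R)
  have a5 : γ * R * Y * L ≤ γ * R * Y * (B / 12) :=
    mul_le_mul_of_nonneg_left (by linarith) (by positivity)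
  have a5' : 0 ≤ γ * R * Y * B := by positivity
  -- The shifts 28, 12 and 24 in these squares produce the constants 98, 54 and 36.
  have a6 : 0 ≤ B / 8 * (Y - 28 * γ * R) ^ 2 := by positivity
  have a7 : 0 ≤ 3 * L * γ / 8 * (W - 12 * γ * R) ^ 2 := by positivity
  have a7' : 3 * L * (γ * W ^ 2) ≤ p * (γ * W ^ 2) :=
    mul_le_mul_of_nonneg_right hp (by positivity)
  have a8 : 0 ≤ ρ / 16 * (D - 24 * γ * R / ρ) ^ 2 := by positivity
  have a9 : ρ / 16 * (D - 24 * γ * R / ρ) ^ 2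
      = ρ / 16 * D ^ 2 - 3 * γ * R * D + R ^ 2 * (36 * γ ^ 2 / ρ) := by field_simp; ring
  have a10 : p * γ * W ^ 2 * γ ≤ p * γ * W ^ 2 * (1 / 36) :=
    mul_le_mul_of_nonneg_left hγ' (by positivity)
  have a11 : 0 ≤ p * γ * W ^ 2 := by positivity
  nlinarith

variable {h : Vec dx → ℝ} {c : Vec dx → Vec dy} {ybar : Vec dy} {L p : ℝ}

/-- Pass through the minimizer at y: the primal error bound reaches it from x, and p ≥ 3L makes the
Lipschitz constant L/(p − L) in y at most 1/2. -/
lemma IsLSmooth.norm_sub_argminX_proj_le (hf : IsLSmooth (lagr h c) ybar L) (hL : 0 < L)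
    (hp : 3 * L ≤ p) {y y' : Vec dy} (hy : y ∈ box ybar) (hy' : y' ∈ box ybar) (x z : Vec dx) :
    ‖argminX (lagr h c) p z y' - x‖
      ≤ ‖y' - y‖ / 2 + ‖gradK (lagr h c) p z x y‖ / (p - L) := by
  have hm : 0 < p - L := by linarith
  have h1 := hf.norm_argminX_sub_le (p := p) (by linarith) hy' hy z
  have h2 := hf.norm_sub_argminX_le (p := p) (by linarith) hy z x
  have h3 : ‖argminX (lagr h c) p z y - x‖ ≤ ‖gradK (lagr h c) p z x y‖ / (p - L) := by
    rw [norm_sub_rev, le_div_iff₀ hm, mul_comm]; exact h2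
  have h4 : ‖argminX (lagr h c) p z y' - argminX (lagr h c) p z y‖ ≤ ‖y' - y‖ / 2 := by
    refine le_of_mul_le_mul_left (h1.trans ?_) hm
    have : 0 ≤ (p - 3 * L) * ‖y' - y‖ := mul_nonneg (by linarith) (norm_nonneg _)
    linarith
  exact (norm_sub_le_norm_sub_add_norm_sub _ (argminX (lagr h c) p z y) _).trans (add_le_add h4 h3)

lemma IsLSmooth.norm_argminX_move_center_le (hf : IsLSmooth (lagr h c) ybar L) (hL : 0 < L)
    (hp : 3 * L ≤ p) {y : Vec dy} (hy : y ∈ box ybar) (z z' : Vec dx) :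
    ‖argminX (lagr h c) p z y - argminX (lagr h c) p z' y‖ ≤ 3 / 2 * ‖z - z'‖ := by
  have hm : 0 < p - L := by linarith
  refine le_of_mul_le_mul_left ((hf.norm_argminX_sub_le_center (p := p) (by linarith)
    (by linarith) hy z z').trans ?_) hm
  have : 0 ≤ (p - 3 * L) * ‖z - z'‖ := mul_nonneg (by linarith) (norm_nonneg _)
  linarith

/-- The mixed minimizer difference is split at the minimizer for the new centre and the new dual
maximizer: the dual error bound handles one part, Lipschitz dependence on the centre the other. -/
lemma IsLSmooth.potential_move_center_le' (hf : IsLSmooth (lagr h c) ybar L) (hL : 0 < L)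
    (hp : 3 * L ≤ p) {β γ R ρ : ℝ} (hβ : 0 < β) (hβL : 12 * L * β ≤ 1) (hγ : 0 < γ)
    (hγ' : γ ≤ 1 / 36) (hR : ‖ybar‖ ≤ R) (hρ : 0 < ρ) {y : Vec dy} (hy : y ∈ box ybar)
    (x x' z : Vec dx) :
    potential (lagr h c) ybar p
        ⟨x', projBox ybar (y + β • c x), γ • x' + (1 - γ) • z⟩
      ≤ potential (lagr h c) ybar p ⟨x', projBox ybar (y + β • c x), z⟩
        - p * γ / 2 * ‖x' - z‖ ^ 2 + ‖projBox ybar (y + β • c x) - y‖ ^ 2 / β / 8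
        + ρ / 16 * ‖gradK (lagr h c) p z x y‖ ^ 2
        + R ^ 2 * (98 * γ ^ 2 / β + 54 * L * γ ^ 3 + 36 * γ ^ 2 / ρ) := by
  have hm : 0 < p - L := by linarith
  have hpL : L < p := by linarith
  have hy' := projBox_mem hy (y + β • c x)
  set z' := γ • x' + (1 - γ) • z with hz'
  have hmove := hf.potential_move_center_le hpL x' hy' z γ
  have herr := hf.dual_error_bound hL.le hpL hβ x hy z'
  rw [← hz'] at hmove
  set y' := projBox ybar (y + β • c x)
  obtain ⟨hs, -⟩ := hf.argmaxY_spec hpL ⟨_, hy⟩ z'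
  set s := argmaxY (lagr h c) ybar p z'
  have hd : z' - z = γ • (x' - z) := by rw [hz']; module
  have hdn : ‖z' - z‖ = γ * ‖x' - z‖ := by rw [hd, norm_smul, Real.norm_of_nonneg hγ.le]
  have hT0 := hf.norm_sub_argminX_proj_le (p := p) hL hp hy hy' x z
  have hT1 := hf.norm_argminX_move_center_le (p := p) hL hp hy' z' z
  have hS := hf.norm_argminX_move_center_le (p := p) hL hp hs z' z
  have hT : ‖argminX (lagr h c) p z' y' - x‖
      ≤ 3 / 2 * (γ * ‖x' - z‖) + (‖y' - y‖ / 2 + ‖gradK (lagr h c) p z x y‖ / (p - L)) := by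
    rw [← hdn]
    exact (norm_sub_le_norm_sub_add_norm_sub _ (argminX (lagr h c) p z y') _).trans
      (add_le_add hT1 hT0)
  have hLT := mul_le_mul_of_nonneg_left hT hL.le
  have hLD : L * (‖gradK (lagr h c) p z x y‖ / (p - L)) ≤ ‖gradK (lagr h c) p z x y‖ / 2 := by
    rw [mul_div_assoc', div_le_iff₀ hm]
    nlinarith [norm_nonneg (gradK (lagr h c) p z x y)]
  have hR0 : 0 ≤ R := (norm_nonneg _).trans hR
  have herr' : (p - L) * ‖argminX (lagr h c) p z' y' - argminX (lagr h c) p z' s‖ ^ 2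
      ≤ (‖y' - y‖ * (1 / β) + L * ‖argminX (lagr h c) p z' y' - x‖) * R := by
    rw [mul_one_div]
    exact herr.trans (mul_le_mul_of_nonneg_left hR (by positivity))
  have habs := center_error_absorb (B := 1 / β) hL hp hγ hγ' hR0 hρ
    (by rw [le_div_iff₀ hβ]; exact hβL) (W := ‖x' - z‖)
    (norm_nonneg (y' - y)) rfl herr'
    (D := ‖gradK (lagr h c) p z x y‖) (by linarith)
  have hin : ⟪x' - z, argminX (lagr h c) p z' y' - argminX (lagr h c) p z s⟫
      ≤ ‖x' - z‖ * (‖argminX (lagr h c) p z' y' - argminX (lagr h c) p z' s‖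
        + 3 / 2 * γ * ‖x' - z‖) := by
    refine (real_inner_le_norm _ _).trans (mul_le_mul_of_nonneg_left ?_ (norm_nonneg _))
    rw [mul_assoc, ← hdn]
    exact (norm_sub_le_norm_sub_add_norm_sub _ (argminX (lagr h c) p z' s) _).trans
      (add_le_add_right hS _)
  have hp0 : 0 < p := by linarith
  have hin' := mul_le_mul_of_nonneg_left hin (by positivity : 0 ≤ 2 * p * γ)
  simp only [mul_one_div] at habs
  linarith

/-- The change of the potential caused by the dual step. -/
lemma IsLSmooth.potential_dual_step_le (hf : IsLSmooth (lagr h c) ybar L) (hL : 0 < L)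
    (hp : 3 * L ≤ p) {β ρ : ℝ} (hβ : 0 < β) (hβL : 12 * L * β ≤ 1) (hρ : 0 < ρ)
    (hβρ : 52 * L ^ 2 * β ≤ ρ * (p - L) ^ 2) {y : Vec dy} (hy : y ∈ box ybar) (x x' z : Vec dx) :
    potential (lagr h c) ybar p ⟨x', projBox ybar (y + β • c x), z⟩
      ≤ potential (lagr h c) ybar p ⟨x, y, z⟩
        + (smoothed (lagr h c) p z x' (projBox ybar (y + β • c x))
          - smoothed (lagr h c) p z x (projBox ybar (y + β • c x)))
        + ρ / 16 * ‖gradK (lagr h c) p z x y‖ ^ 2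
        - 121 / 200 * (‖projBox ybar (y + β • c x) - y‖ ^ 2 / β) := by
  have hm : 0 < p - L := by linarith
  have hy' := projBox_mem hy (y + β • c x)
  have hproj := inner_projBox_le hy (y + β • c x)
  set y' := projBox ybar (y + β • c x)
  set D := ‖gradK (lagr h c) p z x y‖
  set B := 1 / β with hB
  have hBβ : B * β = 1 := by rw [hB]; field_simp
  have hB0 : 0 < B := by positivity
  have hT := hf.norm_sub_argminX_proj_le (p := p) hL hp hy hy' x z
  have hdual := hf.inner_le_dual_sub_dual (p := p) (by linarith) hy y' z
  have hsm := smoothed_sub_smoothed (h := h) (c := c) (p := p) z x y y'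
  set a := argminX (lagr h c) p z y'
  -- The factor 2 on d acts here: K contributes ⟪c x, y' − y⟫ and −2d at most −2⟪c a, y' − y⟫, in
  -- total −⟪c x, y' − y⟫ + 2⟪c x − c a, y' − y⟫. The first term is the ascent gained by projection.
  have h1 : ‖y' - y‖ ^ 2 * B ≤ ⟪c x, y' - y⟫ := by
    have e1 : y + β • c x - y' = β • c x - (y' - y) := by abel
    have e2 : y - y' = -(y' - y) := by abel
    rw [e1, e2, inner_neg_right, inner_sub_left, inner_smul_left, RCLike.conj_to_real,
      real_inner_self_eq_norm_sq] at hproj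
    have := mul_le_mul_of_nonneg_right (by linarith : ‖y' - y‖ ^ 2 ≤ β * ⟪c x, y' - y⟫) hB0.le
    calc _ ≤ _ := this
      _ = (B * β) * ⟪c x, y' - y⟫ := by ring
      _ = _ := by rw [hBβ, one_mul]
  have h2 : ⟪c x - c a, y' - y⟫ ≤ L * (‖y' - y‖ / 2 + D / (p - L)) * ‖y' - y‖ := by
    refine (real_inner_le_norm _ _).trans (mul_le_mul_of_nonneg_right ?_ (norm_nonneg _))
    rw [norm_sub_rev]
    exact (hf.norm_c_sub_le hy a x).trans (mul_le_mul_of_nonneg_left hT hL.le)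
  rw [inner_sub_left] at h2
  have h3 : 2 * (L * (D / (p - L)) * ‖y' - y‖)
      ≤ ρ / 16 * D ^ 2 + 16 * L ^ 2 / (ρ * (p - L) ^ 2) * ‖y' - y‖ ^ 2 := by
    have h4 : 0 ≤ ρ / 16 * (D - 16 * L / (ρ * (p - L)) * ‖y' - y‖) ^ 2 := by positivity
    have h5 : ρ / 16 * (D - 16 * L / (ρ * (p - L)) * ‖y' - y‖) ^ 2
        = ρ / 16 * D ^ 2 - 2 * (L * (D / (p - L)) * ‖y' - y‖)
          + 16 * L ^ 2 / (ρ * (p - L) ^ 2) * ‖y' - y‖ ^ 2 := by field_simp; ring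
    linarith
  -- The 52 in the hypothesis is 16 · 13/4. The balance 1 − 1/12 − 4/13 exceeds 121/200.
  have h4 : 16 * L ^ 2 / (ρ * (p - L) ^ 2) ≤ 4 / 13 * B := by
    rw [hB, mul_one_div, div_le_div_iff₀ (by positivity) hβ]
    linarith
  have h5 := mul_le_mul_of_nonneg_right h4 (sq_nonneg ‖y' - y‖)
  have h6 : 12 * L ≤ B := by rw [hB, le_div_iff₀ hβ]; exact hβL
  have h7 := mul_le_mul_of_nonneg_right h6 (sq_nonneg ‖y' - y‖)
  have h8 : ‖y' - y‖ ^ 2 / β = ‖y' - y‖ ^ 2 * B := by rw [hB, mul_one_div]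
  have h9 : 0 ≤ ‖y' - y‖ ^ 2 * B := by positivity
  simp only [potential]
  rw [h8]
  linarith

/-- One step of the algorithm changes the potential by a deterministic amount plus a sum over
the sampled block. -/
lemma IsLSmooth.potential_step_le (hf : IsLSmooth (lagr h c) ybar L) (hL : 0 < L)
    (hp : 3 * L ≤ p) {α β γ r R ρ : ℝ} (hα : 0 < α) (hαp : α * (p + L) ≤ 1) (hβ : 0 < β)
    (hβL : 12 * L * β ≤ 1) (hρ : 0 < ρ) (hβρ : 52 * L ^ 2 * β ≤ ρ * (p - L) ^ 2)
    (hγ : 0 < γ) (hγ' : γ ≤ 1 / 36) (hR : ‖ybar‖ ≤ R) (hr : 0 < r) (I : Finset (Fin dx))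
    (s : State dx dy) (hs : s.y ∈ box ybar) :
    potential (lagr h c) ybar p (step (lagr h c) ybar p α β γ r I s)
      ≤ potential (lagr h c) ybar p s
        + ∑ i ∈ I, (-(2 / 9 * α) * gradK (lagr h c) p s.z s.x s.y i ^ 2
          + 3 / 2 * α * (gradX (lagr h c) s.x (projBox ybar (s.y + β • c s.x))
            - gradX (lagr h c) s.x s.y) i ^ 2)
        + I.card * (2 * α * (L * r / 2) ^ 2) - p * γ / 4 * ‖s.x - s.z‖ ^ 2
        + ρ / 8 * ‖gradK (lagr h c) p s.z s.x s.y‖ ^ 2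
        - 12 / 25 * (‖projBox ybar (s.y + β • c s.x) - s.y‖ ^ 2 / β)
        + R ^ 2 * (98 * γ ^ 2 / β + 54 * L * γ ^ 3 + 36 * γ ^ 2 / ρ) := by
  obtain ⟨x, y, z⟩ := s
  simp only at hs
  simp only [step, gradY_smoothed]
  set x' := x - α • blockEst (lagr h c) p r I x y z with hx'
  have hy' := projBox_mem hs (y + β • c x)
  have h1 := hf.potential_move_center_le' hL hp hβ hβL hγ hγ' hR hρ hs x x' z
  have h2 := hf.potential_dual_step_le hL hp hβ hβL hρ hβρ hs x x' z
  have h3 := hf.smoothed_block_step_le (p := p) hs hy' hα hαp hr I x z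
  have h4 := hf.norm_sq_block_step_le (p := p) hs hr α I x z
  rw [← hx'] at h3 h4
  have hp0 : 0 < p := by linarith
  -- The decrease must be expressed at the current state, so half of the gain in ‖x' − z‖² is traded
  -- for ‖x − z‖²; the resulting ‖x' − x‖² is absorbed by the block sum, where 1/4 − 1/36 = 2/9.
  have h5 : ‖x - z‖ ^ 2 ≤ 2 * ‖x' - z‖ ^ 2 + 2 * ‖x' - x‖ ^ 2 := by
    have h6 := norm_sub_le_norm_sub_add_norm_sub x x' z
    rw [norm_sub_rev x x'] at h6
    nlinarith [sq_nonneg (‖x' - z‖ - ‖x' - x‖), norm_nonneg (x - z)]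
  have h6 := mul_le_mul_of_nonneg_left h5 (by positivity : 0 ≤ p * γ / 4)
  have h7 := mul_le_mul_of_nonneg_left h4 (by positivity : 0 ≤ p * γ / 2)
  have h8 : p * γ / 2 * (α ^ 2 * ∑ i ∈ I, (2 * gradK (lagr h c) p z x y i ^ 2
        + 2 * (L * r / 2) ^ 2))
      ≤ α / 72 * ∑ i ∈ I, (2 * gradK (lagr h c) p z x y i ^ 2 + 2 * (L * r / 2) ^ 2) := by
    rw [← mul_assoc]
    refine mul_le_mul_of_nonneg_right ?_ (Finset.sum_nonneg fun i _ => by positivity)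
    have h9 : α * p ≤ 1 := by nlinarith
    have h10 : α * p * γ ≤ 1 * (1 / 36) := mul_le_mul h9 hγ' hγ.le zero_le_one
    nlinarith
  have h9 : ∑ i ∈ I, (-(α / 4) * gradK (lagr h c) p z x y i ^ 2 + α * (L * r / 2) ^ 2
        + 3 / 2 * α * (gradX (lagr h c) x (projBox ybar (y + β • c x))
            - gradX (lagr h c) x y) i ^ 2)
      + α / 72 * ∑ i ∈ I, (2 * gradK (lagr h c) p z x y i ^ 2 + 2 * (L * r / 2) ^ 2)
      ≤ ∑ i ∈ I, (-(2 / 9 * α) * gradK (lagr h c) p z x y i ^ 2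
          + 3 / 2 * α * (gradX (lagr h c) x (projBox ybar (y + β • c x))
            - gradX (lagr h c) x y) i ^ 2)
        + I.card * (2 * α * (L * r / 2) ^ 2) := by
    rw [← nsmul_eq_mul, ← Finset.sum_const, Finset.mul_sum, ← Finset.sum_add_distrib,
      ← Finset.sum_add_distrib]
    refine Finset.sum_le_sum fun i _ => ?_
    have : 0 ≤ α * (L * r / 2) ^ 2 := by positivity
    linarith
  linarith

end OneStep
-- Uniform block sampling and independence
section Sampling

open MeasureTheory ProbabilityTheory

/-- Exchange the sums: each index lies in a fraction b/dx of all blocks of size b. -/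
lemma sum_powersetCard_sum (b : ℕ) (hb : 1 ≤ b) (hbd : b ≤ dx) (a : Fin dx → ℝ) :
    ∑ t ∈ Finset.powersetCard b (Finset.univ : Finset (Fin dx)), 1 / (dx.choose b : ℝ) * ∑ i ∈ t, a i
      = (b : ℝ) / dx * ∑ i, a i := by
  have hcard : ∀ i : Fin dx,
      ((((Finset.univ : Finset (Fin dx)).powersetCard b).filter (i ∈ ·)).card : ℝ)
        = ((dx - 1).choose (b - 1) : ℕ) := fun i => by
    have := Finset.card_filter_powersetCard_subset {i} (Finset.univ : Finset (Fin dx)) b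
      (by simp) (by simpa using hb)
    simpa using this
  have h1 : ∑ t ∈ Finset.powersetCard b (Finset.univ : Finset (Fin dx)), ∑ i ∈ t, a i
      = ((dx - 1).choose (b - 1) : ℕ) * ∑ i, a i := by
    calc _ = ∑ t ∈ Finset.powersetCard b (Finset.univ : Finset (Fin dx)),
          ∑ i, if i ∈ t then a i else 0 := by simp
      _ = ∑ i, ∑ t ∈ Finset.powersetCard b (Finset.univ : Finset (Fin dx)),
          if i ∈ t then a i else 0 := Finset.sum_comm
      _ = _ := by
          rw [Finset.mul_sum]
          refine Finset.sum_congr rfl fun i _ => ?_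
          rw [← Finset.sum_filter, Finset.sum_const, nsmul_eq_mul, hcard]
  rw [← Finset.mul_sum, h1, ← mul_assoc]
  congr 1
  obtain ⟨b, rfl⟩ := Nat.exists_eq_add_of_le' hb
  obtain ⟨d, rfl⟩ := Nat.exists_eq_add_of_le' (hb.trans hbd)
  have h2 := Nat.add_one_mul_choose_eq d b
  have h3 : (0 : ℝ) < ((d + 1).choose (b + 1) : ℕ) := by exact_mod_cast Nat.choose_pos hbd
  have h4 : ((d + 1 : ℕ) : ℝ) * (d.choose b : ℕ) = ((d + 1).choose (b + 1) : ℕ) * (b + 1 : ℕ) := by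
    exact_mod_cast h2
  simp only [Nat.add_sub_cancel]
  have h5 : (0 : ℝ) < ((d + 1 : ℕ) : ℝ) := by positivity
  rw [one_div_mul_eq_div, div_eq_div_iff h3.ne' h5.ne']
  linarith

variable {Ω : Type*} [MeasurableSpace Ω] {μ : Measure Ω} [IsProbabilityMeasure μ]

/-- Iterates depend on finitely many finite-valued draws, so no measurability of the potential or of
the stationarity measure is needed. -/
lemma integrable_comp_of_finite {S : Type*} [Finite S] [MeasurableSpace S]
    [MeasurableSingletonClass S] {H : Ω → S} (hH : Measurable H) (φ : S → ℝ) :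
    Integrable (fun ω => φ (H ω)) μ := by
  have : IsProbabilityMeasure (μ.map H) := Measure.isProbabilityMeasure_map hH.aemeasurable
  exact (Integrable.of_finite (μ := μ.map H) (f := φ)).comp_measurable hH

/-- Replaces conditioning on the history: decompose over the values of J and factor each term by
independence. -/
lemma integral_comp_indep_of_finite {S T : Type*} [Finite S] [Fintype T] [MeasurableSpace S]
    [MeasurableSpace T] [MeasurableSingletonClass S] [MeasurableSingletonClass T]
    {H : Ω → S} {J : Ω → T} (hH : Measurable H) (hJ : Measurable J) (hHJ : IndepFun H J μ)
    (F : S → T → ℝ) :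
    ∫ ω, F (H ω) (J ω) ∂μ = ∫ ω, ∑ t, μ.real {ω | J ω = t} * F (H ω) t ∂μ := by
  classical
  have hdec : ∀ ω, F (H ω) (J ω) = ∑ t, F (H ω) t * (if J ω = t then 1 else 0) := fun ω => by
    simp
  have hJt : ∀ t, Integrable (fun ω => if J ω = t then (1 : ℝ) else 0) μ := fun t =>
    integrable_comp_of_finite hJ fun j => if j = t then (1 : ℝ) else 0
  have hHt : ∀ t, Integrable (fun ω => F (H ω) t) μ := fun t =>
    integrable_comp_of_finite hH fun s => F s t
  have hind : ∀ t, IndepFun (fun ω => F (H ω) t) (fun ω => if J ω = t then (1 : ℝ) else 0) μ :=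
    fun t => hHJ.comp (φ := fun s => F s t) (ψ := fun j => if j = t then (1 : ℝ) else 0)
      (measurable_of_finite _) (measurable_of_finite _)
  have hone : ∀ t, ∫ ω, (if J ω = t then (1 : ℝ) else 0) ∂μ = μ.real {ω | J ω = t} := fun t => by
    have hm : MeasurableSet {ω | J ω = t} := hJ (measurableSet_singleton t)
    rw [← integral_indicator_one hm]
    refine integral_congr_ae (Filter.Eventually.of_forall fun ω => ?_)
    simp [Set.indicator_apply]
  have hmul : ∀ t, Integrable (fun ω => F (H ω) t * (if J ω = t then 1 else 0)) μ := fun t =>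
    (hind t).integrable_mul (hHt t) (hJt t)
  simp_rw [hdec]
  rw [integral_finsetSum _ fun t _ => hmul t, integral_finsetSum _ fun t _ => (hHt t).const_mul _]
  refine Finset.sum_congr rfl fun t _ => ?_
  rw [(hind t).integral_fun_mul_eq_mul_integral (hHt t).aestronglyMeasurable
    (hJt t).aestronglyMeasurable, hone, integral_const_mul, mul_comm]

variable {f : Vec dx → Vec dy → ℝ} {ybar : Vec dy} {p α β γ : ℝ} {r : ℕ → ℝ}

lemma iterate_congr (x₀ : Vec dx) (y₀ : Vec dy) {I I' : ℕ → Finset (Fin dx)} {k : ℕ}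
    (hI : ∀ j < k, I j = I' j) :
    iterate f ybar p α β γ r x₀ y₀ I k = iterate f ybar p α β γ r x₀ y₀ I' k := by
  induction k with
  | zero => rfl
  | succ k ih =>
    rw [iterate, iterate, ih fun j hj => hI j (hj.trans k.lt_succ_self), hI k k.lt_succ_self]

lemma iterate_mem_box (x₀ : Vec dx) {y₀ : Vec dy} (hy₀ : y₀ ∈ box ybar)
    (I : ℕ → Finset (Fin dx)) (k : ℕ) : (iterate f ybar p α β γ r x₀ y₀ I k).y ∈ box ybar := by
  cases k with
  | zero => exact hy₀
  | succ k => exact projBox_mem hy₀ _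

/-- The iterate as a function of the blocks drawn before it. -/
def iterateOfHistory (f : Vec dx → Vec dy → ℝ) (ybar : Vec dy) (p α β γ : ℝ) (r : ℕ → ℝ)
    (x₀ : Vec dx) (y₀ : Vec dy) (k : ℕ) (H : Finset.range k → Finset (Fin dx)) : State dx dy :=
  -- The default ∅ is never read: iterate k uses only the blocks with index below k.
  iterate f ybar p α β γ r x₀ y₀ (fun j => if hj : j ∈ Finset.range k then H ⟨j, hj⟩ else ∅) k

lemma iterate_eq_iterateOfHistory (x₀ : Vec dx) (y₀ : Vec dy) (I : ℕ → Finset (Fin dx)) (k : ℕ) :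
    iterate f ybar p α β γ r x₀ y₀ I k
      = iterateOfHistory f ybar p α β γ r x₀ y₀ k fun j => I j :=
  iterate_congr x₀ y₀ fun j hj => by simp [hj]

variable {b : ℕ} {I : ℕ → Ω → Finset (Fin dx)}

lemma IsBlockSampling.integrable_iterate (hI : IsBlockSampling μ b I) (x₀ : Vec dx) (y₀ : Vec dy)
    (k : ℕ) (φ : State dx dy → ℝ) :
    Integrable (fun ω => φ (iterate f ybar p α β γ r x₀ y₀ (fun j => I j ω) k)) μ := by
  let : MeasurableSpace (Finset (Fin dx)) := ⊤
  have hm : ∀ k, Measurable (I k) := fun k =>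
    measurable_to_countable' fun s => hI.measurable k s
  simp_rw [iterate_eq_iterateOfHistory]
  exact integrable_comp_of_finite (H := fun ω (j : Finset.range k) => I j ω)
    (measurable_pi_lambda _ fun j => hm j)
    fun H => φ (iterateOfHistory f ybar p α β γ r x₀ y₀ k H)

/-- The current state is a function of the earlier blocks, hence independent of the block about to
be used. -/
lemma IsBlockSampling.integral_iterate_block (hI : IsBlockSampling μ b I) (x₀ : Vec dx)
    (y₀ : Vec dy) (k : ℕ) (F : State dx dy → Finset (Fin dx) → ℝ) :
    ∫ ω, F (iterate f ybar p α β γ r x₀ y₀ (fun j => I j ω) k) (I k ω) ∂μ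
      = ∫ ω, ∑ t ∈ Finset.powersetCard b (Finset.univ : Finset (Fin dx)), 1 / (dx.choose b : ℝ)
          * F (iterate f ybar p α β γ r x₀ y₀ (fun j => I j ω) k) t ∂μ := by
  let : MeasurableSpace (Finset (Fin dx)) := ⊤
  have hm : ∀ k, Measurable (I k) := fun k =>
    measurable_to_countable' fun s => hI.measurable k s
  have hind : IndepFun (fun ω (j : Finset.range k) => I j ω) (I k) μ := by
    have hproj : Measurable fun g : ({k} : Finset ℕ) → Finset (Fin dx) =>
        g ⟨k, Finset.mem_singleton_self k⟩ := measurable_pi_apply _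
    exact (hI.indep.indepFun_finset (Finset.range k) {k} (by simp) hm).comp measurable_id hproj
  simp_rw [iterate_eq_iterateOfHistory]
  rw [integral_comp_indep_of_finite (H := fun ω (j : Finset.range k) => I j ω) (J := I k)
    (measurable_pi_lambda _ fun j => hm j) (hm k) hind
    fun H t => F (iterateOfHistory f ybar p α β γ r x₀ y₀ k H) t]
  refine integral_congr_ae (Filter.Eventually.of_forall fun ω => ?_)
  simp only [hI.uniform, ite_mul, zero_mul]
  rw [← Finset.sum_filter]
  refine Finset.sum_congr ?_ fun _ _ => rfl
  ext t; simp

end Sampling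
-- Expected decrease and its sum
section Convergence

open MeasureTheory ProbabilityTheory

/-- The expected decrease of the potential in one step, up to error terms. -/
def decrease (f : Vec dx → Vec dy → ℝ) (ybar : Vec dy) (p α β γ N : ℝ) (s : State dx dy) : ℝ :=
  α / N / 16 * ‖gradK f p s.z s.x s.y‖ ^ 2 + p * γ / 4 * ‖s.x - s.z‖ ^ 2
    + ‖projBox ybar (s.y + β • gradY f s.x s.y) - s.y‖ ^ 2 / β / 4

/-- Since ∇ₓ f = ∇ₓ K − p(x − z), the three contributions to the squared measure match the three
terms of `decrease`, with one condition on M for each. -/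
lemma sq_norm_proxGrad_le (f : Vec dx → Vec dy → ℝ) (ybar : Vec dy) {p α β γ N M : ℝ}
    (hN : 0 < N) (hβ : 0 < β) (hp : 0 ≤ p) (hMα : 32 * N ≤ M * α) (hMγ : 8 * p ≤ M * γ)
    (hMβ : 4 ≤ M * β) (s : State dx dy) :
    ‖proxGrad f ybar β s.x s.y‖ ^ 2 ≤ M * decrease f ybar p α β γ N s := by
  rw [WithLp.prod_norm_sq_eq_of_L2]
  simp only [proxGrad, decrease, WithLp.toLp_fst, WithLp.toLp_snd]
  set v := projBox ybar (s.y + β • gradY f s.x s.y)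
  rw [norm_smul, norm_sub_rev, Real.norm_of_nonneg (by positivity : 0 ≤ 1 / β)]
  have h1 : ‖gradX f s.x s.y‖ ≤ ‖gradK f p s.z s.x s.y‖ + p * ‖s.x - s.z‖ := by
    have e : gradX f s.x s.y = gradK f p s.z s.x s.y - p • (s.x - s.z) := by
      rw [gradK, add_sub_cancel_right]
    rw [e]
    refine (norm_sub_le _ _).trans_eq ?_
    rw [norm_smul, Real.norm_of_nonneg hp]
  set D := ‖gradK f p s.z s.x s.y‖
  set Z := ‖s.x - s.z‖
  set Y := ‖v - s.y‖
  have h2 : ‖gradX f s.x s.y‖ ^ 2 ≤ 2 * D ^ 2 + 2 * p ^ 2 * Z ^ 2 := by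
    have := pow_le_pow_left₀ (norm_nonneg _) h1 2
    linarith [sq_nonneg (D - p * Z)]
  have h3 : 2 * D ^ 2 ≤ M * (α / N / 16 * D ^ 2) := by
    have : 2 ≤ M * (α / N / 16) := by
      rw [← mul_div_assoc, ← mul_div_assoc, le_div_iff₀ (by norm_num), le_div_iff₀ hN]; linarith
    linarith [mul_le_mul_of_nonneg_right this (sq_nonneg D)]
  have h4 : 2 * p ^ 2 * Z ^ 2 ≤ M * (p * γ / 4 * Z ^ 2) := by
    have := mul_le_mul_of_nonneg_left hMγ (by positivity : 0 ≤ p * Z ^ 2 / 4)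
    linarith
  have h5 : (1 / β * Y) ^ 2 ≤ M * (Y ^ 2 / β / 4) := by
    have := mul_le_mul_of_nonneg_left hMβ (by positivity : 0 ≤ (1 / β * Y) ^ 2 / 4)
    have e : (1 / β * Y) ^ 2 / 4 * (M * β) = M * (Y ^ 2 / β / 4) := by field_simp
    linarith
  linarith

lemma norm_proxGrad_le {ybar : Vec dy} (f : Vec dx → Vec dy → ℝ) {β : ℝ} (hβ : 0 < β)
    (x : Vec dx) {y : Vec dy} (hy : y ∈ box ybar) :
    ‖proxGrad f ybar β x y‖ ≤ ‖gradXY f x y‖ := by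
  refine le_of_sq_le_sq ?_ (norm_nonneg _)
  rw [WithLp.prod_norm_sq_eq_of_L2, WithLp.prod_norm_sq_eq_of_L2]
  refine add_le_add le_rfl (pow_le_pow_left₀ (norm_nonneg _) ?_ 2)
  have h1 := norm_sub_projBox_add_le hy (β • gradY f x y)
  rw [norm_smul, Real.norm_of_nonneg hβ.le] at h1
  simp only [proxGrad, gradXY, WithLp.toLp_snd]
  rw [norm_smul, Real.norm_of_nonneg (by positivity : 0 ≤ 1 / β), one_div_mul_eq_div,
    div_le_iff₀ hβ, mul_comm]
  exact h1

variable {h : Vec dx → ℝ} {c : Vec dx → Vec dy} {ybar : Vec dy} {L p α β γ R N : ℝ} {b : ℕ}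

lemma IsLSmooth.average_potential_step_le (hf : IsLSmooth (lagr h c) ybar L) (hL : 0 < L)
    (hp : 3 * L ≤ p) (hα : 0 < α) (hα' : α * (p + 10 * L + 1) ≤ 1) (hβ : 0 < β)
    (hβL : 12 * L * β ≤ 1) (hβN : 4 * L * N * β ≤ α ^ 2 * (p - L) ^ 2)
    (hγ : 0 < γ) (hγ' : γ ≤ 1 / 36) (hR : ‖ybar‖ ≤ R) (hb : 1 ≤ b) (hbd : b ≤ dx)
    (hN : N = (dx : ℝ) / b) {r : ℝ} (hr : 0 < r) (s : State dx dy) (hs : s.y ∈ box ybar) :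
    ∑ t ∈ Finset.powersetCard b (Finset.univ : Finset (Fin dx)), 1 / (dx.choose b : ℝ)
        * potential (lagr h c) ybar p (step (lagr h c) ybar p α β γ r t s)
      ≤ potential (lagr h c) ybar p s - decrease (lagr h c) ybar p α β γ N s
        + (b * (2 * α * (L * r / 2) ^ 2)
          + R ^ 2 * (98 * γ ^ 2 / β + 54 * L * γ ^ 3 + 36 * γ ^ 2 / (α / N))) := by
  have hb0 : (0 : ℝ) < b := by exact_mod_cast hb
  have hbd' : (b : ℝ) ≤ dx := by exact_mod_cast hbd
  have hN1 : 1 ≤ N := by rw [hN, one_le_div hb0]; exact hbd'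
  have hN0 : 0 < N := by linarith
  have hαL : 13 * (α * L) ≤ 1 := by nlinarith
  have hαp : α * (p + L) ≤ 1 := by nlinarith [mul_pos hα hL]
  -- After averaging, the gradient term is only worth (2/9)α/N, so the Young weight must scale the
  -- same way; 2/9 − 1/8 still exceeds 1/16.
  set ρ := α / N with hρdef
  have hρ : 0 < ρ := by positivity
  have hρα : ρ ≤ α := div_le_self hα.le hN1
  have hβρ : 52 * L ^ 2 * β ≤ ρ * (p - L) ^ 2 := by
    rw [hρdef, div_mul_eq_mul_div, le_div_iff₀ hN0]
    have h1 := mul_le_mul_of_nonneg_left hβN (by positivity : 0 ≤ 13 * L)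
    have h2 := mul_le_mul_of_nonneg_right hαL (by positivity : 0 ≤ α * (p - L) ^ 2)
    linarith
  have hchoose : (0 : ℝ) < (dx.choose b : ℕ) := by exact_mod_cast Nat.choose_pos hbd
  set δ := gradX (lagr h c) s.x (projBox ybar (s.y + β • c s.x)) - gradX (lagr h c) s.x s.y
    with hδ
  set g := gradK (lagr h c) p s.z s.x s.y
  set Y := ‖projBox ybar (s.y + β • c s.x) - s.y‖
  set a : Fin dx → ℝ := fun i => -(2 / 9 * α) * g i ^ 2 + 3 / 2 * α * δ i ^ 2 with ha
  set E := potential (lagr h c) ybar p s + b * (2 * α * (L * r / 2) ^ 2)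
    - p * γ / 4 * ‖s.x - s.z‖ ^ 2 + ρ / 8 * ‖g‖ ^ 2 - 12 / 25 * (Y ^ 2 / β)
    + R ^ 2 * (98 * γ ^ 2 / β + 54 * L * γ ^ 3 + 36 * γ ^ 2 / ρ) with hE
  have hpt : ∀ t ∈ Finset.powersetCard b (Finset.univ : Finset (Fin dx)),
      1 / (dx.choose b : ℝ) * potential (lagr h c) ybar p (step (lagr h c) ybar p α β γ r t s)
        ≤ 1 / (dx.choose b : ℝ) * E + 1 / (dx.choose b : ℝ) * ∑ i ∈ t, a i := fun t ht => by
    rw [← mul_add]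
    refine mul_le_mul_of_nonneg_left ?_ (by positivity)
    have h1 := hf.potential_step_le hL hp hα hαp hβ hβL hρ hβρ hγ hγ' hR hr t s hs
    rw [(Finset.mem_powersetCard.1 ht).2] at h1
    linarith
  refine (Finset.sum_le_sum hpt).trans ?_
  rw [Finset.sum_add_distrib, sum_powersetCard_sum b hb hbd a, Finset.sum_const,
    Finset.card_powersetCard, Finset.card_univ, Fintype.card_fin, nsmul_eq_mul, ← mul_assoc,
    mul_one_div_cancel hchoose.ne', one_mul]
  have hsum : (b : ℝ) / dx * ∑ i, a i = -(2 / 9 * ρ) * ‖g‖ ^ 2 + 3 / 2 * ρ * ‖δ‖ ^ 2 := by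
    have e1 : (b : ℝ) / dx = 1 / N := by rw [hN, one_div_div]
    rw [e1, ha, Finset.sum_add_distrib, ← Finset.mul_sum, ← Finset.mul_sum,
      EuclideanSpace.real_norm_sq_eq, EuclideanSpace.real_norm_sq_eq, hρdef]
    ring
  have hδ' : ‖δ‖ ≤ L * Y := by
    have := hf.norm_gradX_sub_le (projBox_mem hs (s.y + β • c s.x)) hs s.x s.x
    rwa [sub_self, norm_zero, zero_add] at this
  have hδ2 : 3 / 2 * ρ * ‖δ‖ ^ 2 ≤ 1 / 10 * (Y ^ 2 / β) := by
    have h1 := pow_le_pow_left₀ (norm_nonneg _) hδ' 2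
    rw [mul_div_assoc' (1 / 10), le_div_iff₀ hβ]
    have h2 : ρ * L ≤ 1 / 13 := by nlinarith
    have h3 : ρ * L * (L * β) ≤ 1 / 13 * (1 / 12) :=
      mul_le_mul h2 (by linarith) (by positivity) (by norm_num)
    have h4 := mul_le_mul_of_nonneg_right h3 (sq_nonneg Y)
    have h5 := mul_le_mul_of_nonneg_left h1 (by positivity : 0 ≤ 3 / 2 * ρ * β)
    have h6 := sq_nonneg Y
    linarith
  have h7 : 0 ≤ Y ^ 2 / β := by positivity
  have h8 : 0 ≤ ρ * ‖g‖ ^ 2 := by positivity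
  simp only [decrease, gradY_lagr]
  rw [hsum, hE]
  linarith

variable {Ω : Type*} [MeasurableSpace Ω] {μ : Measure Ω} [IsProbabilityMeasure μ]
  {I : ℕ → Ω → Finset (Fin dx)}

/-- The expected decreases along the iterates are summable, uniformly in the horizon. -/
lemma IsLSmooth.sum_integral_decrease_le (hf : IsLSmooth (lagr h c) ybar L) (hL : 0 < L)
    (hp : 3 * L ≤ p) (hα : 0 < α) (hα' : α * (p + 10 * L + 1) ≤ 1) (hβ : 0 < β)
    (hβL : 12 * L * β ≤ 1) (hβN : 4 * L * N * β ≤ α ^ 2 * (p - L) ^ 2)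
    (hγ : 0 < γ) (hγ' : γ ≤ 1 / 36) (hR : ‖ybar‖ ≤ R) (hb : 1 ≤ b) (hbd : b ≤ dx)
    (hN : N = (dx : ℝ) / b) {r : ℕ → ℝ} (hr : ∀ k, 0 < r k) (hI : IsBlockSampling μ b I)
    {flow : ℝ} (hflow : ∀ x, flow ≤ Phi (lagr h c) ybar x) (x₀ : Vec dx) {y₀ : Vec dy}
    (hy₀ : y₀ ∈ box ybar) (K : ℕ) :
    ∑ k ∈ Finset.range K, ∫ ω, decrease (lagr h c) ybar p α β γ N
        (iterate (lagr h c) ybar p α β γ r x₀ y₀ (fun j => I j ω) k) ∂μ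
      ≤ potential (lagr h c) ybar p ⟨x₀, y₀, x₀⟩ - flow
        + α * L ^ 2 / 2 * (b * ∑ k ∈ Finset.range K, r k ^ 2)
        + K * (R ^ 2 * (98 * γ ^ 2 / β + 54 * L * γ ^ 3 + 36 * γ ^ 2 / (α / N))) := by
  set E := R ^ 2 * (98 * γ ^ 2 / β + 54 * L * γ ^ 3 + 36 * γ ^ 2 / (α / N)) with hE
  set st : ℕ → Ω → State dx dy := fun k ω =>
    iterate (lagr h c) ybar p α β γ r x₀ y₀ (fun j => I j ω) k with hst
  set V : ℕ → ℝ := fun k => ∫ ω, potential (lagr h c) ybar p (st k ω) ∂μ with hV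
  have hint : ∀ k (φ : State dx dy → ℝ), Integrable (fun ω => φ (st k ω)) μ := fun k φ =>
    hI.integrable_iterate x₀ y₀ k φ
  have hstep : ∀ k, V (k + 1) ≤ V k - ∫ ω, decrease (lagr h c) ybar p α β γ N (st k ω) ∂μ
      + (b * (2 * α * (L * r k / 2) ^ 2) + E) := fun k => by
    have h1 : V (k + 1) = ∫ ω, potential (lagr h c) ybar p
        (step (lagr h c) ybar p α β γ (r k) (I k ω) (st k ω)) ∂μ := rfl
    rw [h1, hI.integral_iterate_block x₀ y₀ k fun s t =>
      potential (lagr h c) ybar p (step (lagr h c) ybar p α β γ (r k) t s)]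
    have h2 : V k - ∫ ω, decrease (lagr h c) ybar p α β γ N (st k ω) ∂μ
        + (b * (2 * α * (L * r k / 2) ^ 2) + E)
        = ∫ ω, (potential (lagr h c) ybar p (st k ω) - decrease (lagr h c) ybar p α β γ N (st k ω)
          + (b * (2 * α * (L * r k / 2) ^ 2) + E)) ∂μ := by
      rw [integral_add (hint k fun s => potential (lagr h c) ybar p s
          - decrease (lagr h c) ybar p α β γ N s) (integrable_const _),
        integral_sub (hint k _) (hint k _), integral_const, probReal_univ, one_smul]
    rw [h2]
    refine integral_mono (hint k fun s => ∑ t ∈ Finset.powersetCard b Finset.univ,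
      1 / (dx.choose b : ℝ) * potential (lagr h c) ybar p
        (step (lagr h c) ybar p α β γ (r k) t s))
      (((hint k _).sub (hint k _)).add (integrable_const _)) fun ω => ?_
    exact hf.average_potential_step_le hL hp hα hα' hβ hβL hβN hγ hγ' hR hb hbd hN (hr k) _
      (iterate_mem_box x₀ hy₀ _ k)
  have htel : ∀ K : ℕ, ∑ k ∈ Finset.range K, ∫ ω, decrease (lagr h c) ybar p α β γ N (st k ω) ∂μ
      ≤ V 0 - V K + α * L ^ 2 / 2 * (b * ∑ k ∈ Finset.range K, r k ^ 2) + K * E := fun K => by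
    induction K with
    | zero => simp
    | succ K ih =>
      rw [Finset.sum_range_succ, Finset.sum_range_succ]
      have := hstep K
      push_cast
      linarith
  have h0 : V 0 = potential (lagr h c) ybar p ⟨x₀, y₀, x₀⟩ := by
    simp [hV, hst, iterate]
  have hlow : flow ≤ V K := by
    have h1 := integral_mono (integrable_const flow) (hint K (potential (lagr h c) ybar p))
      fun ω => hf.le_potential hL.le (by linarith) hflow (st K ω) (iterate_mem_box x₀ hy₀ _ K)
    simpa using h1
  have := htel K
  linarith

lemma sq_integral_le_integral_sq {X : Ω → ℝ} (hX : Integrable X μ)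
    (hX2 : Integrable (fun ω => X ω ^ 2) μ) : (∫ ω, X ω ∂μ) ^ 2 ≤ ∫ ω, X ω ^ 2 ∂μ := by
  set e := ∫ ω, X ω ∂μ
  have h1 : ∫ ω, (2 * e * X ω - e ^ 2) ∂μ ≤ ∫ ω, X ω ^ 2 ∂μ :=
    integral_mono ((hX.const_mul _).sub (integrable_const _)) hX2 fun ω => by
      simp only
      linarith [sq_nonneg (X ω - e)]
  rw [integral_sub (hX.const_mul _) (integrable_const _), integral_const_mul, integral_const,
    probReal_univ, one_smul] at h1
  linarith

end Convergence

/-! ### Orders of magnitude of the step sizes -/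

section StepSizes

variable {L p α θ β γ N : ℝ}

/-- The β bound is at least of order 1/N, because √N + a ≤ √N (1 + a) when N ≥ 1. -/
lemma le_betaMax_mul (hL : 0 < L) (hp : L < p) (hα : 0 < α) (hN : 1 ≤ N) :
    min (1 / (12 * L)) (α ^ 2 * (p - L) ^ 2 / (4 * L * (1 + α * (p - L)) ^ 2))
      ≤ betaMax L p α N * N := by
  have hm : 0 < p - L := sub_pos.2 hp
  have hN0 : 0 < N := by linarith
  have hs : 1 ≤ √N := Real.one_le_sqrt.2 hN
  rw [betaMax, min_mul_of_nonneg _ _ hN0.le]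
  refine min_le_min (le_mul_of_one_le_right (by positivity) hN) ?_
  rw [div_mul_eq_mul_div, div_le_div_iff₀ (by positivity) (by positivity)]
  have h1 : √N + α * (p - L) ≤ √N * (1 + α * (p - L)) := by
    nlinarith [mul_pos hα hm]
  have h2 := pow_le_pow_left₀ (by positivity) h1 2
  rw [mul_pow, Real.sq_sqrt hN0.le] at h2
  have h3 := mul_le_mul_of_nonneg_left h2 (by positivity : 0 ≤ 4 * L * (α ^ 2 * (p - L) ^ 2))
  linarith

lemma mul_le_of_le_betaMax (hL : 0 < L) (hp : L < p) (hα : 0 < α) (hN : 1 ≤ N)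
    (hβ : 0 ≤ β) (h : β ≤ betaMax L p α N) :
    12 * L * β ≤ 1 ∧ 4 * L * N * β ≤ α ^ 2 * (p - L) ^ 2 := by
  have hm : 0 < p - L := sub_pos.2 hp
  have hN0 : 0 < N := by linarith
  have h1 := h.trans (min_le_left _ _)
  have h2 := h.trans (min_le_right _ _)
  have hs : 0 < √N := Real.sqrt_pos.2 hN0
  rw [le_div_iff₀ (by positivity)] at h1 h2
  refine ⟨by linarith, le_trans ?_ h2⟩
  have h3 : N ≤ (√N + α * (p - L)) ^ 2 := by
    calc N = √N ^ 2 := (Real.sq_sqrt hN0.le).symm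
      _ ≤ _ := pow_le_pow_left₀ hs.le (by nlinarith [mul_pos hα hm]) 2
  have h4 := mul_le_mul_of_nonneg_left h3 (by positivity : 0 ≤ 4 * L * β)
  linarith

/-- Multiplying by q = √(KN) turns the first entry into 1 and does not shrink the others; 12Lβ ≤ 1
makes the last at least L/(64p). -/
lemma le_gammaMax_mul (hp : 0 < p) (hβ : 0 < β) (hβL : 12 * L * β ≤ 1) {K : ℕ} {q : ℝ}
    (hq : 1 ≤ q) (hqK : q ^ 2 = K * N) :
    min (1 / 36) (L / (64 * p)) ≤ gammaMax p β N K * q := by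
  have hq0 : 0 < q := by linarith
  have h1 : √(1 / (K * N)) * q = 1 := by
    rw [← hqK, Real.sqrt_div zero_le_one, Real.sqrt_one, Real.sqrt_sq hq0.le,
      one_div_mul_cancel hq0.ne']
  rw [gammaMax, min_mul_of_nonneg _ _ hq0.le, min_mul_of_nonneg _ _ hq0.le, h1]
  refine le_min ((min_le_left _ _).trans (by norm_num)) (min_le_min (by linarith) ?_)
  refine le_trans ?_ (le_mul_of_one_le_right (by positivity) hq)
  rw [div_le_div_iff₀ (by positivity) (by positivity)]
  have := mul_le_mul_of_nonneg_left hβL (by positivity : 0 ≤ 64 * p)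
  linarith

end StepSizes
-- From summable decrease to the rate
section Rate

/-- The total of the expected decreases is bounded by a constant. -/
def totalBound (L p α R Δ w : ℝ) : ℝ :=
  Δ + 2 * (Δ * R) + Δ ^ 2 / (p - L) + α * L ^ 2 / 2 + R ^ 2 * (98 / w + 2 * L + 36 / α)

/-- The bound KNγ² ≤ 1 pays for the factors 1/β ≤ N/w and N/α; since N ≥ 1 it also gives Kγ² ≤ 1 for
the cubic term. -/
lemma mul_error_le {L α β γ N K w : ℝ} (hL : 0 < L) (hα : 0 < α) (hβ : 0 < β) (hN : 1 ≤ N)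
    (hγ : 0 < γ) (hγ' : γ ≤ 1 / 36) (hw : 0 < w) (hwβ : w ≤ β * N) (hγK : K * N * γ ^ 2 ≤ 1) :
    K * (98 * γ ^ 2 / β + 54 * L * γ ^ 3 + 36 * γ ^ 2 / (α / N)) ≤ 98 / w + 2 * L + 36 / α := by
  have hN0 : 0 < N := by linarith
  have hKγ : K * γ ^ 2 ≤ 1 := by
    by_contra! hlt
    nlinarith
  have h1 : K * (98 * γ ^ 2 / β) ≤ 98 / w := by
    rw [mul_div_assoc', div_le_div_iff₀ hβ hw]
    rcases le_total 0 K with hK | hK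
    · have := mul_le_mul_of_nonneg_left hwβ (by positivity : 0 ≤ K * γ ^ 2)
      have := mul_le_mul_of_nonneg_right hγK hβ.le
      linarith
    · have := mul_nonneg_of_nonpos_of_nonpos hK (neg_nonpos.2 (by positivity : 0 ≤ γ ^ 2 * w))
      linarith
  have h2 : K * (54 * L * γ ^ 3) ≤ 2 * L := by
    have h3 := mul_le_mul_of_nonneg_right hKγ (by positivity : 0 ≤ 54 * L * γ)
    have h4 := mul_le_mul_of_nonneg_left hγ' (by positivity : 0 ≤ 54 * L)
    linarith
  have h3 : K * (36 * γ ^ 2 / (α / N)) ≤ 36 / α := by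
    have e : K * (36 * γ ^ 2 / (α / N)) = 36 * (K * N * γ ^ 2) / α := by field_simp
    rw [e]
    exact div_le_div_of_nonneg_right (by linarith) hα.le
  linarith

lemma scaled_bounds {p α β γ N q u w : ℝ} (hα : 0 < α) (hu : 0 < u) (hw : 0 < w) (hp : 0 < p)
    (hq : 0 ≤ q) (hqN : N ≤ q) (hγ : u ≤ γ * q) (hβN : w ≤ β * N) (hβ : 0 ≤ β) :
    32 * N ≤ q * (32 / α + 8 * p / u + 4 / w) * α ∧ 8 * p ≤ q * (32 / α + 8 * p / u + 4 / w) * γ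
      ∧ 4 ≤ q * (32 / α + 8 * p / u + 4 / w) * β := by
  have h1 : 0 < 32 / α := by positivity
  have h2 : 0 < 8 * p / u := by positivity
  have h3 : 0 < 4 / w := by positivity
  have e1 : 32 / α * α = 32 := div_mul_cancel₀ _ hα.ne'
  have e2 : 8 * p / u * u = 8 * p := div_mul_cancel₀ _ hu.ne'
  have e3 : 4 / w * w = 4 := div_mul_cancel₀ _ hw.ne'
  set M := 32 / α + 8 * p / u + 4 / w with hM
  have hM1 : 32 / α ≤ M := by linarith
  have hM2 : 8 * p / u ≤ M := by linarith
  have hM3 : 4 / w ≤ M := by linarith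
  have hM0 : 0 ≤ M := by linarith
  clear_value M
  refine ⟨?_, ?_, ?_⟩
  · calc 32 * N ≤ 32 * q := by linarith
      _ = q * (32 / α * α) := by rw [e1, mul_comm]
      _ ≤ q * (M * α) := mul_le_mul_of_nonneg_left (mul_le_mul_of_nonneg_right hM1 hα.le) hq
      _ = _ := by ring
  · calc 8 * p = 8 * p / u * u := e2.symm
      _ ≤ M * (γ * q) := mul_le_mul hM2 hγ hu.le hM0
      _ = _ := by ring
  · calc 4 = 4 / w * w := e3.symm
      _ ≤ M * (β * q) :=
        mul_le_mul hM3 (hβN.trans (mul_le_mul_of_nonneg_left hqN hβ)) hw.le hM0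
      _ = _ := by ring

open MeasureTheory in
/-- The convergence rate, for step sizes satisfying the bounds that the analysis uses. -/
lemma IsLSmooth.exists_integral_norm_proxGrad_le {h : Vec dx → ℝ} {c : Vec dx → Vec dy}
    {ybar : Vec dy} {L p α β γ R Δ N u w t : ℝ} {b K : ℕ} {Ω : Type*} [MeasurableSpace Ω]
    {μ : Measure Ω} [IsProbabilityMeasure μ] {I : ℕ → Ω → Finset (Fin dx)}
    (hf : IsLSmooth (lagr h c) ybar L) (hL : 0 < L)
    (hp : 3 * L ≤ p) (hα : 0 < α) (hα' : α * (p + 10 * L + 1) ≤ 1) (hβ : 0 < β)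
    (hβL : 12 * L * β ≤ 1) (hβN' : 4 * L * N * β ≤ α ^ 2 * (p - L) ^ 2)
    (hγ : 0 < γ) (hγ' : γ ≤ 1 / 36) (hR : ‖ybar‖ ≤ R) (hb : 1 ≤ b) (hbd : b ≤ dx)
    (hN : N = (dx : ℝ) / b) {r : ℕ → ℝ} (hr : ∀ k, 0 < r k) (hI : IsBlockSampling μ b I)
    {flow : ℝ} (hflow : ∀ x, flow ≤ Phi (lagr h c) ybar x) (x₀ : Vec dx) {y₀ : Vec dy}
    (hy₀ : y₀ ∈ box ybar) (hΔ : Phi (lagr h c) ybar x₀ - flow ≤ Δ)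
    (hG : ‖gradXY (lagr h c) x₀ y₀‖ ≤ Δ) (hK : 1 ≤ K)
    (hrsum : ∑ k ∈ Finset.range (K + 1), r k ^ 2 ≤ 1 / (b : ℝ)) (hw : 0 < w) (hu : 0 < u)
    (hβN : w ≤ β * N) (hγK : K * N * γ ^ 2 ≤ 1) (ht0 : 0 ≤ t) (hqN : N ≤ K * t ^ 2)
    (hγq : u ≤ γ * (K * t ^ 2)) :
    ∃ k < K, ∫ ω, ‖proxGrad (lagr h c) ybar β
        (iterate (lagr h c) ybar p α β γ r x₀ y₀ (fun j => I j ω) k).x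
        (iterate (lagr h c) ybar p α β γ r x₀ y₀ (fun j => I j ω) k).y‖ ∂μ
      ≤ t * √((32 / α + 8 * p / u + 4 / w) * totalBound L p α R Δ w) := by
  have hp0 : 0 < p := by linarith
  have hpL : L < p := by linarith
  have hm : 0 < p - L := sub_pos.2 hpL
  have hΔ0 : 0 ≤ Δ := (norm_nonneg _).trans hG
  have hK0 : (0 : ℝ) < K := by exact_mod_cast hK
  have hb0 : (0 : ℝ) < b := by exact_mod_cast hb
  have hN1 : 1 ≤ N := by
    rw [hN, one_le_div hb0]; exact_mod_cast hbd
  have hN0 : 0 < N := by linarith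
  have hM0 : 0 < 32 / α + 8 * p / u + 4 / w := by positivity
  have hq0 : 0 ≤ K * t ^ 2 := by positivity
  have hsum := hf.sum_integral_decrease_le hL hp hα hα' hβ hβL hβN' hγ hγ' hR hb hbd hN hr hI
    hflow x₀ hy₀ K
  have htot : ∑ k ∈ Finset.range K, ∫ ω, decrease (lagr h c) ybar p α β γ N
        (iterate (lagr h c) ybar p α β γ r x₀ y₀ (fun j => I j ω) k) ∂μ
      ≤ totalBound L p α R Δ w := by
    have h1 := hf.potential_init_le hpL x₀ hy₀
    have h2 : ‖gradXY (lagr h c) x₀ y₀‖ * ‖ybar‖ ≤ Δ * R :=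
      mul_le_mul hG hR (norm_nonneg _) hΔ0
    have h3 : ‖gradXY (lagr h c) x₀ y₀‖ ^ 2 / (p - L) ≤ Δ ^ 2 / (p - L) :=
      div_le_div_of_nonneg_right (pow_le_pow_left₀ (norm_nonneg _) hG 2) hm.le
    -- The hypothesis also counts the radius with index K, which is dropped.
    have h4 : b * ∑ k ∈ Finset.range K, r k ^ 2 ≤ 1 := by
      rw [le_div_iff₀ hb0, Finset.sum_range_succ] at hrsum
      nlinarith [mul_nonneg (sq_nonneg (r K)) hb0.le]
    have h5 := mul_le_mul_of_nonneg_left h4 (by positivity : 0 ≤ α * L ^ 2 / 2)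
    have h6 := mul_le_mul_of_nonneg_left
      (mul_error_le hL hα hβ hN1 hγ hγ' hw hβN hγK) (sq_nonneg R)
    rw [totalBound]
    linarith
  set T := totalBound L p α R Δ w
  -- Some expected decrease is at most the average T/K.
  obtain ⟨k, hk, hkT⟩ := Finset.exists_le_of_sum_le (s := Finset.range K)
    (Finset.nonempty_range_iff.2 (by omega)) (g := fun _ => T / K)
    (htot.trans_eq (by rw [Finset.sum_const, Finset.card_range, nsmul_eq_mul]; field_simp))
  refine ⟨k, Finset.mem_range.1 hk, ?_⟩
  set M := 32 / α + 8 * p / u + 4 / w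
  obtain ⟨hMα, hMγ, hMβ⟩ := scaled_bounds hα hu hw hp0 hq0 hqN hγq hβN hβ.le
  have hint : ∀ φ : State dx dy → ℝ, Integrable (fun ω =>
      φ (iterate (lagr h c) ybar p α β γ r x₀ y₀ (fun j => I j ω) k)) μ :=
    hI.integrable_iterate x₀ y₀ k
  have hsq := sq_integral_le_integral_sq (hint fun s => ‖proxGrad (lagr h c) ybar β s.x s.y‖)
    (hint fun s => ‖proxGrad (lagr h c) ybar β s.x s.y‖ ^ 2)
  have hdec := integral_mono (hint fun s => ‖proxGrad (lagr h c) ybar β s.x s.y‖ ^ 2)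
    (hint fun s => K * t ^ 2 * M * decrease (lagr h c) ybar p α β γ N s)
    fun ω => sq_norm_proxGrad_le (lagr h c) ybar hN0 hβ hp0.le hMα hMγ hMβ _
  rw [integral_const_mul] at hdec
  have hfin := hsq.trans (hdec.trans (mul_le_mul_of_nonneg_left hkT (by positivity)))
  have e : K * t ^ 2 * M * (T / K) = t ^ 2 * (M * T) := by field_simp
  rw [e] at hfin
  have hroot := Real.abs_le_sqrt hfin
  rw [Real.sqrt_mul (sq_nonneg t), Real.sqrt_sq ht0] at hroot
  exact (le_abs_self _).trans hroot

end Rate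

end ZOB

end

/-! ### Choice of the constant and the two regimes -/

open ZOB MeasureTheory in
theorem theorem2 :
    ∀ L p α R Δ θ : ℝ, 0 < L → 3 * L ≤ p → 0 < α → α ≤ 1 / (p + 10 * L + 1) → 0 < θ →
    ∃ C : ℝ,
      -- the problem
      ∀ (dx dy : ℕ) (h : ZOB.Vec dx → ℝ) (c : ZOB.Vec dx → ZOB.Vec dy) (ybar : ZOB.Vec dy)
        (flow : ℝ),
      ‖ybar‖ ≤ R →
      (∀ x, flow ≤ ZOB.Phi (ZOB.lagr h c) ybar x) →
      ZOB.IsLSmooth (ZOB.lagr h c) ybar L →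
      -- the initial point
      ∀ (x₀ : ZOB.Vec dx) (y₀ : ZOB.Vec dy), y₀ ∈ ZOB.box ybar →
      ZOB.Phi (ZOB.lagr h c) ybar x₀ - flow ≤ Δ →
      ‖ZOB.gradXY (ZOB.lagr h c) x₀ y₀‖ ≤ Δ →
      -- the parameters of the algorithm
      ∀ (K b : ℕ), 1 ≤ K → 1 ≤ b → b ≤ dx →
      ∀ N : ℝ, N = (dx : ℝ) / (b : ℝ) →
      ∀ r : ℕ → ℝ, (∀ k, 0 < r k) → ∑ k ∈ Finset.range (K + 1), r k ^ 2 ≤ 1 / (b : ℝ) →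
      ∀ β γ : ℝ,
      θ * ZOB.betaMax L p α N ≤ β → β ≤ ZOB.betaMax L p α N →
      θ * ZOB.gammaMax p β N K ≤ γ → γ ≤ ZOB.gammaMax p β N K →
      -- the random blocks
      ∀ (Ω : Type*) [MeasurableSpace Ω] (μ : MeasureTheory.Measure Ω)
        [MeasureTheory.IsProbabilityMeasure μ] (I : ℕ → Ω → Finset (Fin dx)),
      ZOB.IsBlockSampling μ b I →
      -- the smallest of the `K` expected stationarity measures is at most `C (N / K) ^ (1 / 4)`
      ∃ k < K,
        ∫ ω, ‖ZOB.proxGrad (ZOB.lagr h c) ybar β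
          (ZOB.iterate (ZOB.lagr h c) ybar p α β γ r x₀ y₀ (fun j => I j ω) k).x
          (ZOB.iterate (ZOB.lagr h c) ybar p α β γ r x₀ y₀ (fun j => I j ω) k).y‖ ∂μ
        ≤ C * (N / (K : ℝ)) ^ (1 / 4 : ℝ) := by
  intro L p α R Δ θ hL hp hα hα1 hθ
  have hp0 : 0 < p := by linarith
  have hpL : L < p := by linarith
  have hm : 0 < p - L := sub_pos.2 hpL
  have hα' : α * (p + 10 * L + 1) ≤ 1 := by rwa [le_div_iff₀ (by positivity)] at hα1
  set wβ := θ * min (1 / (12 * L)) (α ^ 2 * (p - L) ^ 2 / (4 * L * (1 + α * (p - L)) ^ 2))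
  set wγ := θ * min (1 / 36) (L / (64 * p))
  have hwβ : 0 < wβ := mul_pos hθ (lt_min (by positivity) (by positivity))
  have hwγ : 0 < wγ := mul_pos hθ (lt_min (by positivity) (by positivity))
  set M := 32 / α + 8 * p / wγ + 4 / wβ
  -- The summand Δ serves the regime K < N, the square root the regime N ≤ K.
  refine ⟨Δ + √(M * totalBound L p α R Δ wβ), ?_⟩
  intro dx dy h c ybar flow hR hflow hf x₀ y₀ hy₀ hΔ hG K b hK hb hbd N hN r hr hrsum β γ
    hβl hβu hγl hγu Ω _ μ _ I hI
  have hΔ0 : 0 ≤ Δ := (norm_nonneg _).trans hG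
  have hK0 : (0 : ℝ) < K := by exact_mod_cast hK
  have hb0 : (0 : ℝ) < b := by exact_mod_cast hb
  have hN1 : 1 ≤ N := by
    rw [hN, one_le_div hb0]; exact_mod_cast hbd
  have hN0 : 0 < N := by linarith
  have hβN : wβ ≤ β * N := by
    have h1 := mul_le_mul_of_nonneg_left (le_betaMax_mul hL hpL hα hN1) hθ.le
    have h2 := mul_le_mul_of_nonneg_right hβl hN0.le
    linarith
  have hβ : 0 < β := pos_of_mul_pos_left (hwβ.trans_le hβN) hN0.le
  set t := (N / K) ^ (1 / 4 : ℝ) with ht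
  have hx0 : 0 < N / K := by positivity
  have ht0 : 0 < t := Real.rpow_pos_of_pos hx0 _
  have ht4 : t ^ 4 = N / K := by
    rw [ht, ← Real.rpow_natCast, ← Real.rpow_mul hx0.le]; norm_num
  -- If K < N then t ≥ 1, and at k = 0 the measure is deterministic and at most the initial gradient
  -- norm. Otherwise N ≤ √(KN), as the main argument requires.
  rcases lt_or_ge (K : ℝ) N with hKN | hKN
  · refine ⟨0, hK, ?_⟩
    have ht1 : 1 ≤ t := Real.one_le_rpow ((one_le_div hK0).2 hKN.le) (by norm_num)
    simp only [ZOB.iterate, integral_const, probReal_univ, one_smul]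
    calc _ ≤ Δ := (norm_proxGrad_le _ hβ x₀ hy₀).trans hG
      _ ≤ Δ + √(M * totalBound L p α R Δ wβ) := le_add_of_nonneg_right (Real.sqrt_nonneg _)
      _ ≤ _ := le_mul_of_one_le_right (add_nonneg hΔ0 (Real.sqrt_nonneg _)) ht1
  -- As t⁴ = N/K, this q equals √(KN).
  set q := K * t ^ 2 with hq
  have hqK : q ^ 2 = K * N := by
    have : q ^ 2 = K ^ 2 * t ^ 4 := by rw [hq]; ring
    rw [this, ht4]; field_simp
  have hqN : N ≤ q := by
    refine le_of_sq_le_sq ?_ (by positivity)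
    rw [hqK]; nlinarith
  have hq1 : 1 ≤ q := hN1.trans hqN
  have hq0 : 0 < q := by linarith
  obtain ⟨hβL, hβN'⟩ := mul_le_of_le_betaMax hL hpL hα hN1 hβ.le hβu
  have hγq : wγ ≤ γ * q := by
    have h1 := mul_le_mul_of_nonneg_left (le_gammaMax_mul hp0 hβ hβL hq1 hqK) hθ.le
    have h2 := mul_le_mul_of_nonneg_right hγl hq0.le
    linarith
  have hγ : 0 < γ := pos_of_mul_pos_left (hwγ.trans_le hγq) hq0.le
  have hγ' : γ ≤ 1 / 36 := hγu.trans ((min_le_right _ _).trans (min_le_left _ _))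
  have hγK : K * N * γ ^ 2 ≤ 1 := by
    have h1 : γ ≤ √(1 / (K * N)) := hγu.trans (min_le_left _ _)
    have h2 := pow_le_pow_left₀ hγ.le h1 2
    rw [Real.sq_sqrt (by positivity), le_div_iff₀ (by positivity)] at h2
    linarith
  obtain ⟨k, hk, hle⟩ := hf.exists_integral_norm_proxGrad_le hL hp hα hα' hβ hβL hβN' hγ hγ' hR hb
    hbd hN hr hI hflow x₀ hy₀ hΔ hG hK hrsum hwβ hwγ hβN hγK ht0.le hqN hγq
  refine ⟨k, hk, hle.trans ?_⟩
  rw [mul_comm t, add_mul Δ]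
  exact le_add_of_nonneg_left (mul_nonneg hΔ0 ht0.le)
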